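/- **Theorem (Euler–Poincaré–Herglotz with symmetry breaking).** Let $G$ be a finite-dimensional real Lie group with Lie algebra $\mathfrak g=T_eG$ (bracket of left-invariant vector fields), $\mathcal L_g$ left translation, $X$ a finite-dimensional real vector space, $\rho:G\to \mathrm{GL}(X)$ a smooth representation, and $\rho^*_g=\rho(g^{-1})^*$ the induced representation on $X^*$. Let $\rho'_\xi$ be the infinitesimal representation of $\mathfrak g$ on $X$ and $\rho'^*_\xi$ that on $X^*$, so $\langle\rho'^*_\xi\alpha,x\rangle=-\langle\alpha,\rho'_\xi x\rangle$. Let $\xi_X$ be the infinitesimal generator of the action of $G$ on $X$ and $\mathbf J_X:X\times X^*\to\mathfrak g^*$, $\langle \mathbf J_X(x,\alpha),\xi\rangle=\langle\alpha,\xi_X(x)\rangle$. Let $L_{\mathrm{ext}}:TG\times\mathbb R\times X^*\to\mathbb R$ be smooth with $$L_{\mathrm{ext}}(T_k\mathcal L_g(v_k),z,\rho^*_g\alpha)=L_{\mathrm{ext}}(v_k,z,\alpha)\qquad(g,k\in G,\ v_k\in T_kG,\ z\in\mathbb R,\ \alpha\in X^*),$$ and put $\ell_{\mathrm{ext}}(\xi,z,\alpha)=L_{\mathrm{ext}}(e,\xi,z,\alpha)$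 on $\mathfrak g\times\mathbb R\times X^*$. Fix $\alpha_0\in X^*$ and put $L_{\alpha_0}=L_{\mathrm{ext}}(\cdot,\cdot,\alpha_0):TG\times\mathbb R\to\mathbb R$. Let $h>0$, let $g:[0,h]\to G$ and $z:[0,h]\to\mathbb R$ be smooth curves, and put $\xi(t)=T_{g(t)}\mathcal L_{g(t)^{-1}}\dot g(t)$ and $\alpha(t)=\rho^*_{g(t)^{-1}}\alpha_0$. Then the following are equivalent. 1. (Herglotz principle) $\dot z=L_{\alpha_0}(g,\dot g,z)$ on $[0,h]$, and for every smooth variation $c(t,s)$, $t\in[0,h]$, $|s|<\varepsilon$, with $c(t,0)=g(t)$, $c(0,s)=g(0)$, $c(h,s)=g(h)$, for which the solutions $z(\cdot,s)$ of $\partial_t z=L_{\alpha_0}(c,\partial_tc,z)$, $z(0,s)=z(0)$, exist on $[0,h]$ for all $|s|<\varepsilon$ (which holds after shrinking $\varepsilon$), $$\frac{d}{ds}\Big|_{s=0}\int_0^hL_{\alpha_0}(c,\partial_tc,z(t,s))\,dt=0.$$ 2. $(g,z)$ satisfies the Herglotz equations for $L_{\alpha_0}$ on $[0,h]$: in all local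 coordinates $(q^i)$ of $G$, with $L=L_{\alpha_0}$, $$\frac{d}{dt}\frac{\partial L}{\partial\dot q^i}=\frac{\partial L}{\partial q^i}+\frac{\partial L}{\partial \dot q^i}\frac{\partial L}{\partial z},\qquad \dot z=L.$$ Equivalently, in the left trivialization $L(g,\xi,z):=L_{\alpha_0}(g,T_e\mathcal L_g\xi,z)$, $$\frac{d}{dt}\frac{\delta L}{\delta\xi}=\mathrm{ad}^*_\xi\frac{\delta L}{\delta\xi}+T_e^*\mathcal L_g\Big(\frac{\delta L}{\delta g}\Big)+\frac{\delta L}{\delta\xi}\frac{\partial L}{\partial z},\qquad \dot g=T_e\mathcal L_g\xi,\qquad \dot z=L.$$ 3. (Reduced constrained principle) $\dot z=\ell_{\mathrm{ext}}(\xi,z,\alpha)$ on $[0,h]$, and for all smooth variations $\xi(t,s)$, $\alpha(t,s)$ of $\xi(t)$, $\alpha(t)$ whose derivatives at $s=0$ have the form $$\delta\xi=\dot\eta+\mathrm{ad}_\xi\eta,\qquad \delta\alpha=-\rho'^*_\eta\alpha,$$ with $\eta:[0,h]\to\mathfrak g$ smooth and $\eta(0)=\eta(h)=0$, and for which the solutions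 $z(\cdot,s)$ of $\partial_tz=\ell_{\mathrm{ext}}(\xi(t,s),z,\alpha(t,s))$, $z(0,s)=z(0)$, exist on $[0,h]$ for all $|s|<\varepsilon$ (which holds after shrinking $\varepsilon$), one has $$\frac{d}{ds}\Big|_{s=0}\int_0^h\ell_{\mathrm{ext}}(\xi(t,s),z(t,s),\alpha(t,s))\,dt=0.$$ 4. $\xi,z,\alpha$ satisfy on $[0,h]$ the Euler–Poincaré–Herglotz equations $$\frac{d}{dt}\frac{\delta\ell_{\mathrm{ext}}}{\delta\xi}=\mathrm{ad}^*_\xi\frac{\delta\ell_{\mathrm{ext}}}{\delta\xi}+\mathbf J_X\Big(\frac{\delta\ell_{\mathrm{ext}}}{\delta\alpha},\alpha\Big)+\frac{\delta\ell_{\mathrm{ext}}}{\delta\xi}\frac{\partial\ell_{\mathrm{ext}}}{\partial z},$$ $$\dot\alpha=-\rho'^*_\xi\alpha,\qquad \alpha(0)=\rho^*_{g(0)^{-1}}\alpha_0,\qquad \dot z=\ell_{\mathrm{ext}}.$$ -/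

import Mathlib

open Set
open scoped Manifold ContDiff

namespace HerglotzReduction

noncomputable section

/-! Throughout, `G` is a finite-dimensional real Lie group modelled on `E`.  The Lie algebra
`𝔤 = T₁G` is Mathlib's `GroupLieAlgebra 𝓘(ℝ, E) G = TangentSpace 𝓘(ℝ, E) (1 : G)`, whose underlying
normed space is `E`; since `TangentSpace` carries no norm, elements of `𝔤` are written with type `E`.
`𝔤*` is `StrongDual ℝ E`, and `X*` is `StrongDual ℝ X`. -/

section LieGroupNotions

variable {E : Type*} [NormedAddCommGroup E] [NormedSpace ℝ E]
  {G : Type*} [TopologicalSpace G] [ChartedSpace E G] [Group G]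

/-- The Lie bracket of `𝔤 = T₁G` (that of left-invariant vector fields). -/
def bracket (G : Type*) [TopologicalSpace G] [ChartedSpace E G] [Group G] (ξ η : E) : E :=
  (⁅(show GroupLieAlgebra 𝓘(ℝ, E) G from ξ), (show GroupLieAlgebra 𝓘(ℝ, E) G from η)⁆ :
    GroupLieAlgebra 𝓘(ℝ, E) G)

/-- `ad_ξ : 𝔤 → 𝔤`, `ad_ξ η = [ξ, η]`.  Its dual `ad*_ξ` is `μ ↦ μ ∘L ad G ξ`. -/
def ad (G : Type*) [TopologicalSpace G] [ChartedSpace E G] [Group G] [FiniteDimensional ℝ E]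
    [LieGroup 𝓘(ℝ, E) ∞ G] (ξ : E) : E →L[ℝ] E :=
  haveI : CompleteSpace E := FiniteDimensional.complete ℝ E
  haveI : LieGroup 𝓘(ℝ, E) (minSmoothness ℝ 3) G :=
    LieGroup.of_le (n := ∞) (by
      rw [minSmoothness_of_isRCLikeNormedField]; exact WithTop.coe_le_coe.2 (le_top (a := (3 : ℕ∞))))
  LinearMap.toContinuousLinearMap
    { toFun := fun η => bracket G ξ η
      map_add' := fun η₁ η₂ =>
        lie_add (L := GroupLieAlgebra 𝓘(ℝ, E) G) (M := GroupLieAlgebra 𝓘(ℝ, E) G) ξ η₁ η₂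
      map_smul' := fun c η =>
        lie_smul (R := ℝ) (L := GroupLieAlgebra 𝓘(ℝ, E) G) (M := GroupLieAlgebra 𝓘(ℝ, E) G)
          c ξ η }

/-- The tangent map `T₁ℒ_g : 𝔤 → T_gG` of left translation by `g`. -/
def leftTangent (g : G) : E →L[ℝ] TangentSpace 𝓘(ℝ, E) g :=
  let A : TangentSpace 𝓘(ℝ, E) (1 : G) →L[ℝ] TangentSpace 𝓘(ℝ, E) (g * 1) :=
    mfderiv 𝓘(ℝ, E) 𝓘(ℝ, E) (fun x : G => g * x) 1
  A

/-- The tangent lift `Tℒ_g : TG → TG` of left translation by `g`. -/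
def tangentLift (g : G) (v : TangentBundle 𝓘(ℝ, E) G) : TangentBundle 𝓘(ℝ, E) G :=
  tangentMap 𝓘(ℝ, E) 𝓘(ℝ, E) (fun x : G => g * x) v

/-- The velocity `ġ(t) ∈ T_{g(t)}G` of a curve defined on `[0, h]` (one-sided at the endpoints). -/
def velocity (h : ℝ) (g : ℝ → G) (t : ℝ) : TangentSpace 𝓘(ℝ, E) (g t) :=
  mfderivWithin 𝓘(ℝ, ℝ) 𝓘(ℝ, E) g (Icc 0 h) t (1 : ℝ)

/-- The curve `(g(t), ġ(t))` in `TG`. -/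
def tangentCurve (h : ℝ) (g : ℝ → G) (t : ℝ) : TangentBundle 𝓘(ℝ, E) G :=
  ⟨g t, velocity h g t⟩

/-- The left-trivialized velocity `ξ(t) = T_{g(t)}ℒ_{g(t)⁻¹}(ġ(t)) ∈ 𝔤`. -/
def bodyVelocity (h : ℝ) (g : ℝ → G) (t : ℝ) : E :=
  let A : TangentSpace 𝓘(ℝ, E) (g t) →L[ℝ] TangentSpace 𝓘(ℝ, E) ((g t)⁻¹ * g t) :=
    mfderiv 𝓘(ℝ, E) 𝓘(ℝ, E) (fun x : G => (g t)⁻¹ * x) (g t)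
  A (velocity h g t)

/-! ### The Herglotz principle and Herglotz' equations for `L : TG × ℝ → ℝ` -/

/-- The Herglotz variational principle
`δ ∫₀ʰ L(g, ġ, z) dt = 0`, `ż = L(g, ġ, z)`, for variations of `g` with fixed endpoints:
for every smooth family `c(t, s)` of curves with `c(t, 0) = g(t)`, `c(0, s) = g(0)`,
`c(h, s) = g(h)`, the action `s ↦ ∫₀ʰ L(c, ∂c/∂t, z(·, s)) dt` has vanishing derivative at `s = 0`,
where `z(·, s)` solves `∂z/∂t = L(c, ∂c/∂t, z)` on `[0, h]` with `z(0, s) = z(0)`. -/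
def HerglotzPrinciple (L : TangentBundle 𝓘(ℝ, E) G → ℝ → ℝ) (h : ℝ) (g : ℝ → G) (z : ℝ → ℝ) :
    Prop :=
  (∀ t ∈ Icc 0 h, HasDerivWithinAt z (L (tangentCurve h g t) (z t)) (Icc 0 h) t) ∧
  ∀ (ε : ℝ) (c : ℝ × ℝ → G) (Z : ℝ × ℝ → ℝ), 0 < ε →
    ContMDiffOn 𝓘(ℝ, ℝ × ℝ) 𝓘(ℝ, E) ∞ c (Icc 0 h ×ˢ Ioo (-ε) ε) →
    (∀ t ∈ Icc 0 h, c (t, 0) = g t) →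
    (∀ s ∈ Ioo (-ε) ε, c (0, s) = g 0 ∧ c (h, s) = g h) →
    (∀ s ∈ Ioo (-ε) ε, Z (0, s) = z 0 ∧ ∀ t ∈ Icc 0 h,
      HasDerivWithinAt (fun τ => Z (τ, s))
        (L (tangentCurve h (fun τ => c (τ, s)) t) (Z (t, s))) (Icc 0 h) t) →
    HasDerivAt
      (fun s => ∫ t in (0 : ℝ)..h, L (tangentCurve h (fun τ => c (τ, s)) t) (Z (t, s))) 0 0

/-- The expression `L(q, v, z)` of `L` in the coordinates `(q, v, z)` on `TG × ℝ` induced by a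
chart `e` of `G`. -/
def chartLagrangian (L : TangentBundle 𝓘(ℝ, E) G → ℝ → ℝ) (e : OpenPartialHomeomorph G E)
    (q v : E) (z : ℝ) : ℝ :=
  L ⟨e.symm q, mfderiv 𝓘(ℝ, E) 𝓘(ℝ, E) e.symm q v⟩ z

/-- The Herglotz equations for `L` in every smooth chart `e` of `G`: with `q = e ∘ g`,
`d/dt (∂L/∂q̇) = ∂L/∂q + (∂L/∂z) ∂L/∂q̇` whenever `g(t)` lies in the chart domain,
and `ż = L(g, ġ, z)`. -/
def HerglotzEquations (L : TangentBundle 𝓘(ℝ, E) G → ℝ → ℝ) (h : ℝ) (g : ℝ → G) (z : ℝ → ℝ) :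
    Prop :=
  (∀ e ∈ IsManifold.maximalAtlas 𝓘(ℝ, E) ∞ G, ∀ t ∈ Icc 0 h, g t ∈ e.source →
    let q : ℝ → E := fun τ => e (g τ)
    let q' : ℝ → E := derivWithin q (Icc 0 h)
    let p : ℝ → StrongDual ℝ E :=
      fun τ => fderiv ℝ (fun v => chartLagrangian L e (q τ) v (z τ)) (q' τ)
    HasDerivWithinAt p
      (fderiv ℝ (fun x => chartLagrangian L e x (q' t) (z t)) (q t)
        + deriv (fun w => chartLagrangian L e (q t) (q' t) w) (z t) • p t) (Icc 0 h) t) ∧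
  ∀ t ∈ Icc 0 h, HasDerivWithinAt z (L (tangentCurve h g t) (z t)) (Icc 0 h) t

/-- The left trivialization `(g, ξ, z) ↦ L(g, T₁ℒ_g ξ, z)` of `L`. -/
def trivializedLagrangian (L : TangentBundle 𝓘(ℝ, E) G → ℝ → ℝ) (g : G) (ξ : E) (z : ℝ) : ℝ :=
  L ⟨g, leftTangent g ξ⟩ z

/-- The Herglotz equations on a Lie group in left-trivialized form, with `ξ = T_gℒ_{g⁻¹} ġ`:
`d/dt (δL/δξ) = ad*_ξ (δL/δξ) + T₁*ℒ_g (δL/δg) + (∂L/∂z) δL/δξ`, `ġ = T₁ℒ_g ξ`, `ż = L`. -/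
def TrivializedHerglotzEquations [FiniteDimensional ℝ E] [LieGroup 𝓘(ℝ, E) ∞ G]
    (L : TangentBundle 𝓘(ℝ, E) G → ℝ → ℝ) (h : ℝ) (g : ℝ → G) (z : ℝ → ℝ) : Prop :=
  let ξ : ℝ → E := bodyVelocity h g
  let p : ℝ → StrongDual ℝ E :=
    fun τ => fderiv ℝ (fun x => trivializedLagrangian L (g τ) x (z τ)) (ξ τ)
  let dg : (t : ℝ) → TangentSpace 𝓘(ℝ, E) (g t) →L[ℝ] ℝ :=
    fun t => mfderiv 𝓘(ℝ, E) 𝓘(ℝ, ℝ) (fun x => trivializedLagrangian L x (ξ t) (z t)) (g t)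
  ∀ t ∈ Icc 0 h,
    HasDerivWithinAt p
      ((p t).comp (ad G (ξ t)) + (dg t).comp (leftTangent (g t))
        + deriv (fun w => trivializedLagrangian L (g t) (ξ t) w) (z t) • p t) (Icc 0 h) t ∧
    velocity h g t = leftTangent (g t) (ξ t) ∧
    HasDerivWithinAt z (trivializedLagrangian L (g t) (ξ t) (z t)) (Icc 0 h) t

end LieGroupNotions

/-! ### Representations, the momentum map, and the reduced system -/

section Reduced

variable {E : Type*} [NormedAddCommGroup E] [NormedSpace ℝ E]
  {G : Type*} [TopologicalSpace G] [ChartedSpace E G] [Group G]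
  {X : Type*} [NormedAddCommGroup X] [NormedSpace ℝ X]

/-- The adjoint representation `ρ*_g α = α ∘ ρ(g⁻¹)` of `G` on `X*`. -/
def dualRep (ρ : G →* (X →L[ℝ] X)) (g : G) (α : StrongDual ℝ X) : StrongDual ℝ X :=
  α.comp (ρ g⁻¹)

/-- The infinitesimal representation `ρ' : 𝔤 → 𝔤𝔩(X)`, the tangent map of `ρ` at the identity. -/
def infRep (ρ : G →* (X →L[ℝ] X)) : E →L[ℝ] (X →L[ℝ] X) :=
  let A : TangentSpace 𝓘(ℝ, E) (1 : G) →L[ℝ] TangentSpace 𝓘(ℝ, X →L[ℝ] X) (ρ 1) :=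
    mfderiv 𝓘(ℝ, E) 𝓘(ℝ, X →L[ℝ] X) ρ 1
  A

/-- The infinitesimal adjoint representation `ρ'* : 𝔤 → 𝔤𝔩(X*)`,
`⟨ρ'*_ξ α, x⟩ = - ⟨α, ρ'_ξ x⟩`. -/
def infDualRep (ρ : G →* (X →L[ℝ] X)) (ξ : E) (α : StrongDual ℝ X) : StrongDual ℝ X :=
  -(α.comp (infRep ρ ξ))

/-- The infinitesimal generator `ξ ↦ ξ_X(x)` of the action `g • x = ρ(g) x` of `G` on `X`. -/
def infGenerator (ρ : G →* (X →L[ℝ] X)) (x : X) : E →L[ℝ] X :=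
  let A : TangentSpace 𝓘(ℝ, E) (1 : G) →L[ℝ] TangentSpace 𝓘(ℝ, X) (ρ 1 x) :=
    mfderiv 𝓘(ℝ, E) 𝓘(ℝ, X) (fun g : G => ρ g x) 1
  A

/-- The momentum map `J_X : X × X* → 𝔤*`, `⟨J_X(x, α), ξ⟩ = ⟨α, ξ_X(x)⟩`. -/
def momentumMap (ρ : G →* (X →L[ℝ] X)) (x : X) (α : StrongDual ℝ X) : StrongDual ℝ E :=
  α.comp (infGenerator ρ x)

/-- The functional derivative `δf/δα ∈ X` of `f : X* → ℝ` at `α`, i.e. the differential of `f`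
at `α` seen as an element of `X** ≃ X`. -/
def dualGradient [FiniteDimensional ℝ X] (f : StrongDual ℝ X → ℝ) (α : StrongDual ℝ X) : X :=
  (Module.evalEquiv ℝ X).symm
    ((fderiv ℝ f α).toLinearMap ∘ₗ
      (LinearMap.toContinuousLinearMap : (X →ₗ[ℝ] ℝ) ≃ₗ[ℝ] (X →L[ℝ] ℝ)).toLinearMap)

lemma apply_dualGradient [FiniteDimensional ℝ X] (f : StrongDual ℝ X → ℝ)
    (α u : StrongDual ℝ X) : u (dualGradient f α) = fderiv ℝ f α u := by
  have := Module.apply_evalEquiv_symm_apply (R := ℝ) (M := X) u.toLinearMap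
    ((fderiv ℝ f α).toLinearMap ∘ₗ
      (LinearMap.toContinuousLinearMap : (X →ₗ[ℝ] ℝ) ≃ₗ[ℝ] (X →L[ℝ] ℝ)).toLinearMap)
  exact this

/-- The reduced extended Lagrangian `ℓ_ext(ξ, z, α) = L_ext(1, ξ, z, α)` on `𝔤 × ℝ × X*`. -/
def reducedLagrangian (L : TangentBundle 𝓘(ℝ, E) G → ℝ → StrongDual ℝ X → ℝ)
    (ξ : E) (z : ℝ) (α : StrongDual ℝ X) : ℝ :=
  L ⟨(1 : G), ξ⟩ z α

/-- The reduced constrained variational principle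
`δ ∫₀ʰ ℓ(ξ, z, α) dt = 0`, `ż = ℓ(ξ, z, α)`, for smooth variations `ξ(t, s)`, `α(t, s)` of the form
`δξ = η̇ + ad_ξ η`, `δα = -ρ'*_η α`, where `η` is a smooth curve in `𝔤` vanishing at `0` and `h`;
here `z(·, s)` solves `∂z/∂t = ℓ(ξ(t, s), z, α(t, s))` on `[0, h]` with `z(0, s) = z(0)`. -/
def ReducedPrinciple [FiniteDimensional ℝ E] [LieGroup 𝓘(ℝ, E) ∞ G] (ρ : G →* (X →L[ℝ] X))
    (ℓ : E → ℝ → StrongDual ℝ X → ℝ) (h : ℝ) (ξ : ℝ → E) (z : ℝ → ℝ) (α : ℝ → StrongDual ℝ X) :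
    Prop :=
  (∀ t ∈ Icc 0 h, HasDerivWithinAt z (ℓ (ξ t) (z t) (α t)) (Icc 0 h) t) ∧
  ∀ (ε : ℝ) (Ξ : ℝ × ℝ → E) (A : ℝ × ℝ → StrongDual ℝ X) (Z : ℝ × ℝ → ℝ) (η : ℝ → E), 0 < ε →
    ContDiffOn ℝ ∞ Ξ (Icc 0 h ×ˢ Ioo (-ε) ε) →
    ContDiffOn ℝ ∞ A (Icc 0 h ×ˢ Ioo (-ε) ε) →
    ContDiffOn ℝ ∞ η (Icc 0 h) → η 0 = 0 → η h = 0 →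
    (∀ t ∈ Icc 0 h, Ξ (t, 0) = ξ t ∧ A (t, 0) = α t) →
    (∀ t ∈ Icc 0 h,
      HasDerivAt (fun s => Ξ (t, s)) (derivWithin η (Icc 0 h) t + ad G (ξ t) (η t)) 0 ∧
      HasDerivAt (fun s => A (t, s)) (-infDualRep ρ (η t) (α t)) 0) →
    (∀ s ∈ Ioo (-ε) ε, Z (0, s) = z 0 ∧ ∀ t ∈ Icc 0 h,
      HasDerivWithinAt (fun τ => Z (τ, s)) (ℓ (Ξ (t, s)) (Z (t, s)) (A (t, s))) (Icc 0 h) t) →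
    HasDerivAt (fun s => ∫ t in (0 : ℝ)..h, ℓ (Ξ (t, s)) (Z (t, s)) (A (t, s))) 0 0

/-- The semidirect-product Euler-Poincaré-Herglotz equations
`d/dt (δℓ/δξ) = ad*_ξ (δℓ/δξ) + J_X(δℓ/δα, α) + (∂ℓ/∂z) δℓ/δξ`, `α̇ = -ρ'*_ξ α`,
`α(0) = ρ*_{g₀⁻¹} α₀`, `ż = ℓ`. -/
def EulerPoincareHerglotzEquations [FiniteDimensional ℝ E] [LieGroup 𝓘(ℝ, E) ∞ G]
    [FiniteDimensional ℝ X] (ρ : G →* (X →L[ℝ] X)) (ℓ : E → ℝ → StrongDual ℝ X → ℝ) (h : ℝ)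
    (g₀ : G) (α₀ : StrongDual ℝ X) (ξ : ℝ → E) (z : ℝ → ℝ) (α : ℝ → StrongDual ℝ X) : Prop :=
  let p : ℝ → StrongDual ℝ E := fun τ => fderiv ℝ (fun x => ℓ x (z τ) (α τ)) (ξ τ)
  α 0 = dualRep ρ g₀⁻¹ α₀ ∧
  ∀ t ∈ Icc 0 h,
    HasDerivWithinAt p
      ((p t).comp (ad G (ξ t))
        + momentumMap ρ (dualGradient (fun a => ℓ (ξ t) (z t) a) (α t)) (α t)
        + deriv (fun w => ℓ (ξ t) w (α t)) (z t) • p t) (Icc 0 h) t ∧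
    HasDerivWithinAt α (-infDualRep ρ (ξ t) (α t)) (Icc 0 h) t ∧
    HasDerivWithinAt z (ℓ (ξ t) (z t) (α t)) (Icc 0 h) t

end Reduced

end

end HerglotzReduction

/-! In the left trivialization a variation of `g` becomes a variation of the body velocity `ξ` and
of the advected parameter `α`. The Maurer–Cartan structure equation gives `δξ = η̇ + ad_ξ η`, with
`η` the left-trivialized variation field, and left invariance of the Lagrangian turns its value
along the curve into `ℓ(ξ, z, α)`. So each variation of `g` is a constrained variation of `(ξ, α)`;
conversely every `η` vanishing at the endpoints comes from a variation of `g`.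

The Herglotz action is `z(h, s) - z(0)`, hence its first variation is `w(h)`, where `w(0) = 0` and
`w` solves the equation `ẇ = (∂ℓ/∂z) w + ⟨p, η̇⟩ + ⟨f, η⟩` obtained by linearizing the one for `z`;
here `p = δℓ/δξ` and `f` is the reduced force `ad*_ξ p + J_X(δℓ/δα, α)`. An integrating factor
removes the term in `w`, after which the du Bois-Reymond argument gives `ṗ = f + (∂ℓ/∂z) p`.

In a chart, `ξ = Λ_q q̇` with `Λ` the Maurer–Cartan form is a quasi-velocity, and the coordinate
Herglotz equations are Hamel's equations, which are the same momentum equation because `Λ_q` is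
invertible and satisfies the structure equation. -/

namespace HerglotzReduction

open Filter Topology Metric
open scoped NNReal

noncomputable section

/-! ### Ordinary differential equations depending on a parameter -/

section ParametrizedODE

variable {V : Type*} [NormedAddCommGroup V] {h ε : ℝ}

/-- The domain `[0, h] × (-ε, ε) × V` of a one-parameter family of differential equations in `V`,
with points written `(t, s, y)`: time, parameter, unknown. -/
abbrev paramDomain (V : Type*) (h ε : ℝ) : Set (ℝ × ℝ × V) := Icc 0 h ×ˢ (Ioo (-ε) ε ×ˢ univ)

/-- The closed tube of radius `R` around the graph of `z` over `[0, h]`, with parameter of absolute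
value at most `r`. -/
def tube (h r R : ℝ) (z : ℝ → V) : Set (ℝ × ℝ × V) :=
  {p | p.1 ∈ Icc 0 h ∧ p.2.1 ∈ closedBall 0 r ∧ p.2.2 ∈ closedBall (z p.1) R}

lemma tube_subset_paramDomain {r : ℝ} (hr : r < ε) (R : ℝ) (z : ℝ → V) :
    tube h r R z ⊆ paramDomain V h ε := by
  rintro ⟨t, s, y⟩ ⟨ht, hs, -⟩
  exact ⟨ht, abs_lt.1 ((mem_closedBall_zero_iff.1 hs).trans_lt hr), mem_univ _⟩

lemma isCompact_tube [ProperSpace V] {z : ℝ → V} (hz : ContinuousOn z (Icc 0 h)) (r R : ℝ) :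
    IsCompact (tube h r R z) := by
  have hshift : ContinuousOn (fun p : ℝ × ℝ × V => (p.1, p.2.1, z p.1 + p.2.2))
      (Icc 0 h ×ˢ (closedBall 0 r ×ˢ closedBall 0 R)) := by
    have : ContinuousOn (fun p : ℝ × ℝ × V => z p.1)
        (Icc 0 h ×ˢ (closedBall 0 r ×ˢ closedBall 0 R)) :=
      hz.comp continuousOn_fst fun p hp => hp.1
    exact continuousOn_fst.prodMk (continuousOn_snd.fst.prodMk (this.add continuousOn_snd.snd))
  convert (isCompact_Icc.prod ((isCompact_closedBall _ _).prod
    (isCompact_closedBall _ _))).image_of_continuousOn hshift using 1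
  ext ⟨t, s, y⟩
  constructor
  · rintro ⟨ht, hs, hy⟩
    exact ⟨(t, s, y - z t), ⟨ht, hs, by simpa [dist_eq_norm] using hy⟩, by simp⟩
  · rintro ⟨⟨t', s', u⟩, ⟨ht, hs, hu⟩, heq⟩
    obtain ⟨rfl, rfl, rfl⟩ : t' = t ∧ s' = s ∧ z t' + u = y := by simpa using heq
    exact ⟨ht, hs, by simpa using hu⟩

variable [NormedSpace ℝ V] {Q W : Type*} [NormedAddCommGroup Q] [NormedSpace ℝ Q]
  [NormedAddCommGroup W] [NormedSpace ℝ W]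

lemma hasDerivWithinAt_Ici_of_Icc {f : ℝ → V} {f' : V} {t : ℝ} (ht : t ∈ Ico 0 h)
    (hf : HasDerivWithinAt f f' (Icc 0 h) t) : HasDerivWithinAt f f' (Ici t) t :=
  hf.mono_of_mem_nhdsWithin (mem_of_superset (Icc_mem_nhdsGE ht.2) (Icc_subset_Icc_left ht.1))

lemma gronwallBound_zero_left_eq_mul (K κ x : ℝ) :
    gronwallBound 0 K κ x = κ * gronwallBound 0 K 1 x := by
  rcases eq_or_ne K 0 with rfl | hK
  · simp [gronwallBound_K0]
  · simp only [gronwallBound_of_K_ne_0 hK]; ring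

lemma gronwallBound_zero_one_nonneg {K x : ℝ} (hK : 0 ≤ K) (hx : 0 ≤ x) :
    0 ≤ gronwallBound 0 K 1 x := by
  simpa only [gronwallBound_x0] using gronwallBound_mono le_rfl zero_le_one hK hx

lemma norm_le_mul_gronwallBound {K κ : ℝ} {f f' : ℝ → V} (hK : 0 ≤ K) (hκ : 0 ≤ κ)
    (hf : ∀ t ∈ Icc 0 h, HasDerivWithinAt f (f' t) (Icc 0 h) t) (h0 : f 0 = 0)
    (hbound : ∀ t ∈ Icc 0 h, ‖f' t‖ ≤ K * ‖f t‖ + κ) {t : ℝ} (ht : t ∈ Icc 0 h) :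
    ‖f t‖ ≤ κ * gronwallBound 0 K 1 h :=
  calc ‖f t‖ ≤ gronwallBound 0 K κ (t - 0) :=
        norm_le_gronwallBound_of_norm_deriv_right_le
          (fun t ht => (hf t ht).continuousWithinAt)
          (fun t ht => hasDerivWithinAt_Ici_of_Icc ht (hf t (Ico_subset_Icc_self ht)))
          (by rw [h0, norm_zero]) (fun t ht => hbound t (Ico_subset_Icc_self ht)) t ht
    _ ≤ gronwallBound 0 K κ h := gronwallBound_mono le_rfl hκ hK (by linarith [ht.2])
    _ = κ * gronwallBound 0 K 1 h := gronwallBound_zero_left_eq_mul K κ h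

lemma exists_solution_of_lipschitz_of_bounded [CompleteSpace V] (hh : 0 < h) {v : ℝ → V → V}
    {K B : ℝ≥0} (hlip : ∀ t ∈ Icc 0 h, LipschitzWith K (v t))
    (hcont : ∀ y, ContinuousOn (fun t => v t y) (Icc 0 h))
    (hbound : ∀ t ∈ Icc 0 h, ∀ y, ‖v t y‖ ≤ B) (y₀ : V) :
    ∃ y : ℝ → V, y 0 = y₀ ∧ ∀ t ∈ Icc 0 h, HasDerivWithinAt y (v t (y t)) (Icc 0 h) t :=
  IsPicardLindelof.exists_eq_forall_mem_Icc_hasDerivWithinAt₀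
    (t₀ := ⟨0, le_rfl, hh.le⟩) (a := B * Real.toNNReal h) (L := B) (K := K)
    { lipschitzOnWith := fun t ht => (hlip t ht).lipschitzOnWith
      continuousOn := fun y _ => hcont y
      norm_le := fun t ht y _ => hbound t ht y
      mul_max_le := by simp [hh.le] }

/-- The derivative at `(t, q)` of `q ↦ F (t, q)`, for a map `F` defined on `S`; it is used to
linearize a differential equation in its parameter and its unknown simultaneously. -/
def sliceFDeriv (S : Set (ℝ × Q)) (F : ℝ × Q → W) (p : ℝ × Q) : Q →L[ℝ] W :=
  (fderivWithin ℝ F S p).comp (ContinuousLinearMap.inr ℝ ℝ Q)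

lemma continuousOn_sliceFDeriv {S : Set (ℝ × Q)} {F : ℝ × Q → W} (hF : ContDiffOn ℝ 1 F S)
    (hS : UniqueDiffOn ℝ S) : ContinuousOn (sliceFDeriv S F) S :=
  (hF.continuousOn_fderivWithin hS le_rfl).clm_comp continuousOn_const

lemma hasFDerivAt_slice {I : Set ℝ} {U : Set Q} (hU : IsOpen U) {F : ℝ × Q → W}
    (hF : DifferentiableOn ℝ F (I ×ˢ U)) {t : ℝ} (ht : t ∈ I) {q : Q} (hq : q ∈ U) :
    HasFDerivAt (fun q => F (t, q)) (sliceFDeriv (I ×ˢ U) F (t, q)) q :=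
  ((hF (t, q) ⟨ht, hq⟩).hasFDerivWithinAt.comp q
    (hasFDerivAt_prodMk_right t q).hasFDerivWithinAt fun _ hy => ⟨ht, hy⟩).hasFDerivAt
    (hU.mem_nhds hq)

lemma uniqueDiffOn_paramDomain (hh : 0 < h) : UniqueDiffOn ℝ (paramDomain V h ε) :=
  (uniqueDiffOn_Icc hh).prod (isOpen_Ioo.prod isOpen_univ).uniqueDiffOn

lemma exists_lipschitzOnWith_tube [ProperSpace V] (hh : 0 < h) {F : ℝ × ℝ × V → W}
    (hF : ContDiffOn ℝ 1 F (paramDomain V h ε)) {z : ℝ → V} (hz : ContinuousOn z (Icc 0 h))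
    {r : ℝ} (hr : r < ε) (R : ℝ) :
    ∃ K : ℝ≥0, ∀ t ∈ Icc 0 h,
      LipschitzOnWith K (fun q => F (t, q)) (closedBall 0 r ×ˢ closedBall (z t) R) := by
  have htube := tube_subset_paramDomain (h := h) hr R z
  obtain ⟨M, hM⟩ := (isCompact_tube hz r R).exists_bound_of_continuousOn
    ((continuousOn_sliceFDeriv hF (uniqueDiffOn_paramDomain hh)).mono htube)
  refine ⟨M.toNNReal, fun t ht => Convex.lipschitzOnWith_of_nnnorm_hasFDerivWithin_le
    (f' := fun q => sliceFDeriv (paramDomain V h ε) F (t, q)) (fun q hq => ?_) (fun q hq => ?_)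
    ((convex_closedBall _ _).prod (convex_closedBall _ _))⟩
  · exact (hasFDerivAt_slice (isOpen_Ioo.prod isOpen_univ) (hF.differentiableOn one_ne_zero) ht
      (htube ⟨ht, hq⟩ : (t, q) ∈ _).2).hasFDerivWithinAt
  · exact NNReal.le_toNNReal_of_coe_le (hM (t, q) ⟨ht, hq⟩)

theorem solution_unique [ProperSpace V] (hh : 0 < h) {F : ℝ × ℝ × V → V}
    (hF : ContDiffOn ℝ 1 F (paramDomain V h ε)) {s : ℝ} (hs : s ∈ Ioo (-ε) ε) {y z : ℝ → V}
    (hy : ∀ t ∈ Icc 0 h, HasDerivWithinAt y (F (t, s, y t)) (Icc 0 h) t)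
    (hz : ∀ t ∈ Icc 0 h, HasDerivWithinAt z (F (t, s, z t)) (Icc 0 h) t)
    (h0 : y 0 = z 0) : EqOn y z (Icc 0 h) := by
  have hyc : ContinuousOn y (Icc 0 h) := fun t ht => (hy t ht).continuousWithinAt
  have hzc : ContinuousOn z (Icc 0 h) := fun t ht => (hz t ht).continuousWithinAt
  obtain ⟨R, hR⟩ := isCompact_Icc.exists_bound_of_continuousOn (hyc.sub hzc)
  obtain ⟨K, hK⟩ := exists_lipschitzOnWith_tube hh hF hzc (abs_lt.2 hs) R
  have hlip : ∀ t ∈ Ico 0 h, LipschitzOnWith K (fun y => F (t, s, y)) (closedBall (z t) R) := by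
    intro t ht
    simpa only [mul_one, Function.comp_def] using (hK t (Ico_subset_Icc_self ht)).comp
      (LipschitzWith.prodMk_left s).lipschitzOnWith fun y hy => ⟨by simp, hy⟩
  refine ODE_solution_unique_of_mem_Icc_right (v := fun t y => F (t, s, y)) hlip
    hyc (fun t ht => hasDerivWithinAt_Ici_of_Icc ht (hy t (Ico_subset_Icc_self ht)))
    (fun t ht => ?_)
    hzc (fun t ht => hasDerivWithinAt_Ici_of_Icc ht (hz t (Ico_subset_Icc_self ht)))
    (fun t ht => ?_) h0
  · exact mem_closedBall_iff_norm.2 (hR t (Ico_subset_Icc_self ht))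
  · exact mem_closedBall_self ((norm_nonneg _).trans (hR t (Ico_subset_Icc_self ht)))

end ParametrizedODE

section ClampedODE

/-- The projection of `y` onto `[c - 1, c + 1]`. Clamping the unknown near a given solution turns a
scalar equation into one with a globally bounded and Lipschitz right-hand side. -/
def clampNear (c y : ℝ) : ℝ := c + projIcc (-1) 1 (by norm_num) (y - c)

lemma clampNear_mem_closedBall (c y : ℝ) : clampNear c y ∈ closedBall c 1 := by
  rw [mem_closedBall_iff_norm, clampNear, add_sub_cancel_left]
  exact abs_le.2 (projIcc (-1 : ℝ) 1 (by norm_num) (y - c)).2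

lemma clampNear_of_mem_closedBall {c y : ℝ} (hy : y ∈ closedBall c 1) : clampNear c y = y := by
  have hyc : y - c ∈ Icc (-1 : ℝ) 1 := abs_le.1 (mem_closedBall_iff_norm.1 hy)
  rw [clampNear, projIcc_of_mem _ hyc, add_sub_cancel]

lemma lipschitzWith_clampNear (c : ℝ) : LipschitzWith 1 (clampNear c) :=
  LipschitzWith.of_dist_le_mul fun y y' => by
    simpa [clampNear, Subtype.dist_eq] using
      (LipschitzWith.projIcc (show (-1 : ℝ) ≤ 1 by norm_num)).dist_le_mul (y - c) (y' - c)

lemma continuous_clampNear_left (y : ℝ) : Continuous fun c => clampNear c y :=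
  continuous_id.add
    (continuous_subtype_val.comp (continuous_projIcc.comp (continuous_const.sub continuous_id)))

variable {h ε r : ℝ} {F : ℝ × ℝ × ℝ → ℝ} {z : ℝ → ℝ}

lemma exists_lipschitzOnWith_clamped (hh : 0 < h) (hF : ContDiffOn ℝ 1 F (paramDomain ℝ h ε))
    (hz : ContinuousOn z (Icc 0 h)) (hr : r < ε) :
    ∃ K : ℝ≥0, ∀ t ∈ Icc 0 h,
      LipschitzOnWith K (fun q : ℝ × ℝ => F (t, q.1, clampNear (z t) q.2))
        (closedBall 0 r ×ˢ univ) := by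
  obtain ⟨K, hK⟩ := exists_lipschitzOnWith_tube hh hF hz hr 1
  refine ⟨K, fun t ht => ?_⟩
  have hclamp : LipschitzWith 1 (fun q : ℝ × ℝ => (q.1, clampNear (z t) q.2)) := by
    simpa using LipschitzWith.prod_fst.prodMk
      ((lipschitzWith_clampNear (z t)).comp LipschitzWith.prod_snd)
  simpa only [mul_one, Function.comp_def] using (hK t ht).comp hclamp.lipschitzOnWith
    fun q hq => ⟨hq.1, clampNear_mem_closedBall _ _⟩

lemma exists_clamped_solution (hh : 0 < h) (hF : ContDiffOn ℝ 1 F (paramDomain ℝ h ε))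
    (hz : ContinuousOn z (Icc 0 h)) (hr : r < ε) {s : ℝ} (hs : s ∈ closedBall 0 r) (y₀ : ℝ) :
    ∃ y : ℝ → ℝ, y 0 = y₀ ∧
      ∀ t ∈ Icc 0 h, HasDerivWithinAt y (F (t, s, clampNear (z t) (y t))) (Icc 0 h) t := by
  have htube := tube_subset_paramDomain (h := h) hr 1 z
  have hmem : ∀ t ∈ Icc 0 h, ∀ y, (t, s, clampNear (z t) y) ∈ tube h r 1 z :=
    fun t ht y => ⟨ht, hs, clampNear_mem_closedBall _ _⟩
  obtain ⟨K, hK⟩ := exists_lipschitzOnWith_clamped hh hF hz hr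
  obtain ⟨B, hB⟩ := (isCompact_tube hz r 1).exists_bound_of_continuousOn
    (hF.continuousOn.mono htube)
  refine exists_solution_of_lipschitz_of_bounded (K := K) (B := B.toNNReal) hh
    (fun t ht => ?_) (fun y => ?_)
    (fun t ht y => (hB _ (hmem t ht y)).trans (Real.le_coe_toNNReal B)) y₀
  · simpa only [mul_one, Function.comp_def, lipschitzOnWith_univ] using (hK t ht).comp
      (LipschitzWith.prodMk_left s).lipschitzOnWith (fun y (_ : y ∈ univ) => ⟨hs, mem_univ y⟩)
  · exact (hF.continuousOn.mono htube).comp (continuousOn_id.prodMk (continuousOn_const.prodMk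
      ((continuous_clampNear_left y).comp_continuousOn hz))) fun t ht => hmem t ht y

lemma abs_clamped_solution_sub_le {K : ℝ≥0}
    (hK : ∀ t ∈ Icc 0 h, LipschitzOnWith K (fun q : ℝ × ℝ => F (t, q.1, clampNear (z t) q.2))
      (closedBall 0 r ×ˢ univ))
    (hz : ∀ t ∈ Icc 0 h, HasDerivWithinAt z (F (t, 0, z t)) (Icc 0 h) t) {s : ℝ}
    (hs : s ∈ closedBall 0 r) {y : ℝ → ℝ} (h0 : y 0 = z 0)
    (hy : ∀ t ∈ Icc 0 h, HasDerivWithinAt y (F (t, s, clampNear (z t) (y t))) (Icc 0 h) t)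
    {t : ℝ} (ht : t ∈ Icc 0 h) :
    |y t - z t| ≤ K * gronwallBound 0 K 1 h * |s| := by
  have hr : 0 ≤ r := dist_nonneg.trans hs
  rw [mul_right_comm]
  refine norm_le_mul_gronwallBound (f := fun t => y t - z t) K.2 (by positivity)
    (fun t ht => (hy t ht).sub (hz t ht)) (by rw [h0, sub_self]) (fun t ht => ?_) ht
  have hclamp : clampNear (z t) (z t) = z t :=
    clampNear_of_mem_closedBall (mem_closedBall_self zero_le_one)
  have hlip := (hK t ht).dist_le_mul (s, y t) ⟨hs, mem_univ _⟩ (0, z t)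
    ⟨mem_closedBall_self hr, mem_univ _⟩
  simp only [hclamp, Prod.dist_eq, dist_zero_right, Real.dist_eq, Real.norm_eq_abs] at hlip
  calc ‖F (t, s, clampNear (z t) (y t)) - F (t, 0, z t)‖ ≤ K * max |s| |y t - z t| := hlip
    _ ≤ K * (|s| + |y t - z t|) := by
        gcongr; exact max_le_add_of_nonneg (abs_nonneg _) (abs_nonneg _)
    _ = K * ‖y t - z t‖ + K * |s| := by rw [Real.norm_eq_abs]; ring

theorem exists_solution_family (hh : 0 < h) (hε : 0 < ε)
    (hF : ContDiffOn ℝ 1 F (paramDomain ℝ h ε))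
    (hz : ∀ t ∈ Icc 0 h, HasDerivWithinAt z (F (t, 0, z t)) (Icc 0 h) t) :
    ∃ δ C : ℝ, 0 < δ ∧ δ < ε ∧ 0 ≤ C ∧ ∃ Z : ℝ × ℝ → ℝ, ∀ s ∈ Ioo (-δ) δ, Z (0, s) = z 0 ∧
      ∀ t ∈ Icc 0 h, HasDerivWithinAt (fun τ => Z (τ, s)) (F (t, s, Z (t, s))) (Icc 0 h) t ∧
        |Z (t, s) - z t| ≤ C * |s| := by
  have hzc : ContinuousOn z (Icc 0 h) := fun t ht => (hz t ht).continuousWithinAt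
  have hr : ε / 2 < ε := half_lt_self hε
  obtain ⟨K, hK⟩ := exists_lipschitzOnWith_clamped hh hF hzc hr
  set C := K * gronwallBound 0 K 1 h
  have hC : 0 ≤ C := mul_nonneg K.2 (gronwallBound_zero_one_nonneg K.2 hh.le)
  choose! Y hY0 hY using fun s (hs : s ∈ closedBall (0 : ℝ) (ε / 2)) =>
    exists_clamped_solution hh hF hzc hr hs (z 0)
  refine ⟨min (ε / 2) (1 / (C + 1)), C, by positivity, (min_le_left _ _).trans_lt hr, hC,
    fun p => Y p.2 p.1, fun s hs => ?_⟩
  obtain ⟨hsε, hsC⟩ : |s| < ε / 2 ∧ |s| < 1 / (C + 1) := lt_min_iff.1 (abs_lt.2 hs)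
  have hsr : s ∈ closedBall 0 (ε / 2) := mem_closedBall_zero_iff.2 hsε.le
  have hclose : ∀ t ∈ Icc 0 h, |Y s t - z t| ≤ C * |s| := fun t ht =>
    abs_clamped_solution_sub_le hK hz hsr (hY0 s hsr) (hY s hsr) ht
  have hCs : C * |s| ≤ 1 := by
    rw [lt_div_iff₀ (by positivity)] at hsC
    linarith [abs_nonneg s]
  refine ⟨hY0 s hsr, fun t ht => ⟨?_, hclose t ht⟩⟩
  simpa only [clampNear_of_mem_closedBall (mem_closedBall_iff_norm.2 ((hclose t ht).trans hCs))]
    using hY s hsr t ht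

lemma exists_abs_solution_family_sub_le {Z : ℝ × ℝ → ℝ} (hh : 0 < h) (hε : 0 < ε)
    (hF : ContDiffOn ℝ 1 F (paramDomain ℝ h ε))
    (hz : ∀ t ∈ Icc 0 h, HasDerivWithinAt z (F (t, 0, z t)) (Icc 0 h) t)
    (hZ : ∀ s ∈ Ioo (-ε) ε, Z (0, s) = z 0 ∧ ∀ t ∈ Icc 0 h,
      HasDerivWithinAt (fun τ => Z (τ, s)) (F (t, s, Z (t, s))) (Icc 0 h) t) :
    ∃ C, 0 ≤ C ∧ ∀ᶠ s in 𝓝 0, ∀ t ∈ Icc 0 h, |Z (t, s) - z t| ≤ C * |s| := by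
  obtain ⟨δ, C, hδ, hδε, hC, Y, hY⟩ := exists_solution_family hh hε hF hz
  refine ⟨C, hC, ?_⟩
  filter_upwards [Ioo_mem_nhds (neg_lt_zero.2 hδ) hδ] with s hs t ht
  have hsε : s ∈ Ioo (-ε) ε := Ioo_subset_Ioo (by linarith) hδε.le hs
  have hZY : Z (t, s) = Y (t, s) := solution_unique hh hF hsε (hZ s hsε).2
    (fun t ht => ((hY s hs).2 t ht).1) ((hZ s hsε).1.trans (hY s hs).1.symm) ht
  exact hZY ▸ ((hY s hs).2 t ht).2

end ClampedODE

section ParameterDerivative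

variable {V : Type*} [NormedAddCommGroup V] [NormedSpace ℝ V] {h ε : ℝ} {F : ℝ × ℝ × V → V}
  {z : ℝ → V}

lemma exists_norm_slice_sub_linearization_le [ProperSpace V] (hh : 0 < h) (hε : 0 < ε)
    (hF : ContDiffOn ℝ 1 F (paramDomain V h ε)) (hz : ContinuousOn z (Icc 0 h)) {κ : ℝ}
    (hκ : 0 < κ) :
    ∃ r, 0 < r ∧ ∀ t ∈ Icc 0 h, ∀ q ∈ ball ((0 : ℝ), z t) r,
      ‖F (t, q) - F (t, 0, z t) - sliceFDeriv (paramDomain V h ε) F (t, 0, z t) (q - (0, z t))‖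
        ≤ κ * ‖q - (0, z t)‖ := by
  have htube := tube_subset_paramDomain (h := h) (half_lt_self hε) 1 z
  obtain ⟨r, hr, hclose⟩ := Metric.uniformContinuousOn_iff.1
    ((isCompact_tube hz _ _).uniformContinuousOn_of_continuous
      ((continuousOn_sliceFDeriv hF (uniqueDiffOn_paramDomain hh)).mono htube)) κ hκ
  refine ⟨min r (min (ε / 2) 1), by positivity, fun t ht q hq => ?_⟩
  have hmem : ∀ q ∈ ball ((0 : ℝ), z t) (min r (min (ε / 2) 1)), (t, q) ∈ tube h (ε / 2) 1 z ∧
      dist (t, q) (t, 0, z t) < r := fun q hq => by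
    simp only [mem_ball, Prod.dist_eq, lt_min_iff, max_lt_iff] at hq
    exact ⟨⟨ht, hq.2.1.1.le, hq.2.2.2.le⟩, by simpa [Prod.dist_eq, hr] using hq.1⟩
  have hcenter : ((0 : ℝ), z t) ∈ ball ((0 : ℝ), z t) (min r (min (ε / 2) 1)) :=
    mem_ball_self (by positivity)
  refine (convex_ball _ _).norm_image_sub_le_of_norm_hasFDerivWithin_le' (𝕜 := ℝ)
    (f := fun q => F (t, q)) (f' := fun q => sliceFDeriv (paramDomain V h ε) F (t, q))
    (fun q hq => (hasFDerivAt_slice (isOpen_Ioo.prod isOpen_univ)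
      (hF.differentiableOn one_ne_zero) ht (htube (hmem q hq).1).2).hasFDerivWithinAt)
    (fun q hq => ?_) hcenter hq
  rw [← dist_eq_norm]
  exact (hclose _ (hmem q hq).1 _ (hmem _ hcenter).1 (hmem q hq).2).le

lemma exists_bound_sliceFDeriv [ProperSpace V] (hh : 0 < h) (hε : 0 < ε)
    (hF : ContDiffOn ℝ 1 F (paramDomain V h ε)) (hz : ContinuousOn z (Icc 0 h)) :
    ∃ K, 0 ≤ K ∧ ∀ t ∈ Icc 0 h, ‖sliceFDeriv (paramDomain V h ε) F (t, 0, z t)‖ ≤ K := by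
  obtain ⟨K, hK⟩ := (isCompact_tube hz 0 0).exists_bound_of_continuousOn
    ((continuousOn_sliceFDeriv hF (uniqueDiffOn_paramDomain hh)).mono
      (tube_subset_paramDomain hε 0 z))
  have hbound : ∀ t ∈ Icc 0 h, ‖sliceFDeriv (paramDomain V h ε) F (t, 0, z t)‖ ≤ K :=
    fun t ht => hK (t, 0, z t) ⟨ht, mem_closedBall_self le_rfl, mem_closedBall_self le_rfl⟩
  exact ⟨K, (norm_nonneg _).trans (hbound 0 ⟨le_rfl, hh.le⟩), hbound⟩

lemma norm_sub_sub_smul_le {D : ℝ → ℝ × V →L[ℝ] V} {y w : ℝ → V} {K κ s : ℝ} (hκ : 0 ≤ κ)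
    (hK : 0 ≤ K) (hD : ∀ t ∈ Icc 0 h, ‖D t‖ ≤ K)
    (hz : ∀ t ∈ Icc 0 h, HasDerivWithinAt z (F (t, 0, z t)) (Icc 0 h) t)
    (hy : ∀ t ∈ Icc 0 h, HasDerivWithinAt y (F (t, s, y t)) (Icc 0 h) t)
    (hw : ∀ t ∈ Icc 0 h, HasDerivWithinAt w (D t (1, w t)) (Icc 0 h) t)
    (hy0 : y 0 = z 0) (hw0 : w 0 = 0)
    (hlin : ∀ t ∈ Icc 0 h,
      ‖F (t, s, y t) - F (t, 0, z t) - D t (s, y t - z t)‖ ≤ κ) {t : ℝ} (ht : t ∈ Icc 0 h) :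
    ‖y t - z t - s • w t‖ ≤ κ * gronwallBound 0 K 1 h := by
  refine norm_le_mul_gronwallBound (f := fun t => y t - z t - s • w t) hK hκ
    (fun t ht => ((hy t ht).sub (hz t ht)).sub ((hw t ht).const_smul s)) (by simp [hy0, hw0])
    (fun t ht => ?_) ht
  have hsplit : D t (s, y t - z t) = D t (0, y t - z t - s • w t) + s • D t (1, w t) := by
    rw [← map_smul, ← map_add]; simp
  have hle : ‖D t (0, y t - z t - s • w t)‖ ≤ K * ‖y t - z t - s • w t‖ := by
    simpa using (D t).le_of_opNorm_le (hD t ht) (0, y t - z t - s • w t)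
  calc ‖F (t, s, y t) - F (t, 0, z t) - s • D t (1, w t)‖
      = ‖D t (0, y t - z t - s • w t)
          + (F (t, s, y t) - F (t, 0, z t) - D t (s, y t - z t))‖ := by
        rw [hsplit]; congr 1; abel
    _ ≤ K * ‖y t - z t - s • w t‖ + κ := (norm_add_le _ _).trans (add_le_add hle (hlin t ht))

theorem hasDerivAt_solution_family [ProperSpace V] (hh : 0 < h) (hε : 0 < ε)
    (hF : ContDiffOn ℝ 1 F (paramDomain V h ε)) {D : ℝ → ℝ × V →L[ℝ] V} {Z : ℝ × ℝ → V}
    {w : ℝ → V} {C : ℝ} (hC : 0 ≤ C)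
    (hD : ∀ t ∈ Icc 0 h, HasFDerivAt (fun q => F (t, q)) (D t) (0, z t))
    (hz : ∀ t ∈ Icc 0 h, HasDerivWithinAt z (F (t, 0, z t)) (Icc 0 h) t)
    (hZ : ∀ᶠ s in 𝓝 0, Z (0, s) = z 0 ∧ ∀ t ∈ Icc 0 h,
      HasDerivWithinAt (fun τ => Z (τ, s)) (F (t, s, Z (t, s))) (Icc 0 h) t)
    (hZz : ∀ᶠ s in 𝓝 0, ∀ t ∈ Icc 0 h, ‖Z (t, s) - z t‖ ≤ C * |s|)
    (hw : ∀ t ∈ Icc 0 h, HasDerivWithinAt w (D t (1, w t)) (Icc 0 h) t) (hw0 : w 0 = 0)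
    {t : ℝ} (ht : t ∈ Icc 0 h) : HasDerivAt (fun s => Z (t, s)) (w t) 0 := by
  have hzc : ContinuousOn z (Icc 0 h) := fun t ht => (hz t ht).continuousWithinAt
  have hDslice : ∀ t ∈ Icc 0 h, sliceFDeriv (paramDomain V h ε) F (t, 0, z t) = D t := fun t ht =>
    (hasFDerivAt_slice (isOpen_Ioo.prod isOpen_univ) (hF.differentiableOn one_ne_zero) ht
      ⟨⟨neg_lt_zero.2 hε, hε⟩, mem_univ _⟩).unique (hD t ht)
  obtain ⟨K, hK, hDK⟩ := exists_bound_sliceFDeriv hh hε hF hzc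
  set Γ := gronwallBound 0 K 1 h
  have hΓ : 0 ≤ Γ := gronwallBound_zero_one_nonneg hK hh.le
  rw [hasDerivAt_iff_isLittleO, Asymptotics.isLittleO_iff]
  intro c hc
  set κ := c / ((1 + C) * (Γ + 1))
  have hκ : 0 < κ := by positivity
  obtain ⟨r, hr, hlin⟩ := exists_norm_slice_sub_linearization_le hh hε hF hzc hκ
  have hsmall : ∀ᶠ s : ℝ in 𝓝 0, (1 + C) * |s| < r :=
    (continuous_const.mul continuous_abs).tendsto' _ _ (by simp) |>.eventually_lt_const hr
  have hZ0 : Z (t, 0) = z t := by simpa [sub_eq_zero] using hZz.self_of_nhds t ht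
  filter_upwards [hZ, hZz, hsmall] with s hZs hZzs hs
  have hnorm : ∀ t ∈ Icc 0 h, ‖(s, Z (t, s)) - (0, z t)‖ ≤ (1 + C) * |s| := fun t ht => by
    simp only [Prod.mk_sub_mk, sub_zero, Prod.norm_mk, Real.norm_eq_abs]
    exact max_le (by nlinarith [abs_nonneg s]) (by linarith [hZzs t ht, abs_nonneg s])
  have herror : ‖Z (t, s) - z t - s • w t‖ ≤ κ * ((1 + C) * |s|) * Γ := by
    refine norm_sub_sub_smul_le (D := D) (by positivity) hK
      (fun t ht => hDslice t ht ▸ hDK t ht) hz hZs.2 hw hZs.1 hw0 (fun t ht => ?_) ht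
    have := hlin t ht (s, Z (t, s)) (mem_ball_iff_norm.2 ((hnorm t ht).trans_lt hs))
    rw [hDslice t ht, Prod.mk_sub_mk, sub_zero] at this
    exact this.trans (mul_le_mul_of_nonneg_left (by simpa using hnorm t ht) hκ.le)
  calc ‖Z (t, s) - Z (t, 0) - (s - 0) • w t‖ ≤ κ * ((1 + C) * |s|) * Γ := by
        rwa [hZ0, sub_zero]
    _ = c * |s| * (Γ / (Γ + 1)) := by simp only [κ]; field_simp
    _ ≤ c * |s| * 1 := by gcongr; rw [div_le_one (by positivity)]; linarith
    _ = c * ‖s - 0‖ := by rw [mul_one, sub_zero, Real.norm_eq_abs]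

end ParameterDerivative

/-! ### The Maurer–Cartan form -/

section MaurerCartan

variable {E : Type*} [NormedAddCommGroup E] [NormedSpace ℝ E]
  {G : Type*} [TopologicalSpace G] [ChartedSpace E G] [Group G]
  {F' : Type*} [NormedAddCommGroup F'] [NormedSpace ℝ F']
  {F : Type*} [NormedAddCommGroup F] [NormedSpace ℝ F]

/-- The tangent map `T_gℒ_{g⁻¹} : T_gG → 𝔤`, that is, the left Maurer–Cartan form `θ` of `G`
at `g`. -/
def leftTangentInv (g : G) : TangentSpace 𝓘(ℝ, E) g →L[ℝ] E :=
  let A : TangentSpace 𝓘(ℝ, E) g →L[ℝ] TangentSpace 𝓘(ℝ, E) (g⁻¹ * g) :=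
    mfderiv 𝓘(ℝ, E) 𝓘(ℝ, E) (fun x : G => g⁻¹ * x) g
  A

/-- The pullback `c*θ` of the left Maurer–Cartan form `θ` of `G` along a map `c` defined on `S`;
it takes the junk value `0` where `c` is not differentiable. -/
def maurerCartan (S : Set F) (c : F → G) (p : F) : F →L[ℝ] E :=
  (leftTangentInv (c p)).comp (mfderivWithin 𝓘(ℝ, F) 𝓘(ℝ, E) c S p)

lemma leftTangentInv_congr {g g' : G} (hg : g = g') :
    (leftTangentInv g : E →L[ℝ] E) = leftTangentInv g' := by
  rw [hg]

lemma maurerCartan_eq_of_hasMFDerivWithinAt {S : Set F} {c : F → G} {p : F}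
    {c' : F →L[ℝ] TangentSpace 𝓘(ℝ, E) (c p)}
    (hc : HasMFDerivWithinAt 𝓘(ℝ, F) 𝓘(ℝ, E) c S p c') (hS : UniqueDiffWithinAt ℝ S p) :
    maurerCartan S c p = (leftTangentInv (c p)).comp c' := by
  rw [maurerCartan, hc.mfderivWithin hS.uniqueMDiffWithinAt]

lemma maurerCartan_mono {S T : Set F} (hST : S ⊆ T) {c : F → G} {p : F}
    (hc : MDifferentiableWithinAt 𝓘(ℝ, F) 𝓘(ℝ, E) c T p) (hS : UniqueDiffWithinAt ℝ S p) :
    maurerCartan (E := E) S c p = maurerCartan T c p :=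
  maurerCartan_eq_of_hasMFDerivWithinAt (hc.hasMFDerivWithinAt.mono hST) hS

lemma maurerCartan_of_isOpen {S : Set F} (hS : IsOpen S) (c : F → G) {p : F} (hp : p ∈ S) :
    maurerCartan (E := E) S c p =
      (leftTangentInv (c p)).comp (mfderiv 𝓘(ℝ, F) 𝓘(ℝ, E) c p) := by
  rw [maurerCartan, mfderivWithin_of_isOpen hS hp]
  rfl

lemma maurerCartan_comp {S : Set F} {T : Set F'} {c : F → G} {c₁ : F' → G} {f : F → F'} {p : F}
    (hc₁ : MDifferentiableWithinAt 𝓘(ℝ, F') 𝓘(ℝ, E) c₁ T (f p))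
    (hf : DifferentiableWithinAt ℝ f S p) (hp : p ∈ S) (hS : UniqueDiffWithinAt ℝ S p)
    (hfT : ∀ᶠ x in 𝓝[S] p, f x ∈ T) (hc : c =ᶠ[𝓝[S] p] c₁ ∘ f) :
    maurerCartan (E := E) S c p = (maurerCartan T c₁ (f p)).comp (fderivWithin ℝ f S p) := by
  have hcomp : HasMFDerivWithinAt 𝓘(ℝ, F) 𝓘(ℝ, E) (c₁ ∘ f) S p
      ((mfderivWithin 𝓘(ℝ, F') 𝓘(ℝ, E) c₁ T (f p)).comp (fderivWithin ℝ f S p)) :=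
    (hc₁.hasMFDerivWithinAt.comp p
      (hf.hasFDerivWithinAt.hasMFDerivWithinAt.mono inter_subset_left)
      inter_subset_right).mono_of_mem_nhdsWithin (inter_mem self_mem_nhdsWithin hfT)
  have hcp : c p = c₁ (f p) := hc.self_of_nhdsWithin hp
  have hcongr := hcomp.congr_of_eventuallyEq hc hcp
  rw [maurerCartan_eq_of_hasMFDerivWithinAt hcongr hS]
  exact congrArg (fun A : E →L[ℝ] E => A.comp _) (leftTangentInv_congr hcp)

lemma contMDiffAt_extChartAt_one {y : G} (hy : y = 1) :
    ContMDiffAt 𝓘(ℝ, E) 𝓘(ℝ, E) ∞ (extChartAt 𝓘(ℝ, E) (1 : G)) y :=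
  hy ▸ contMDiffAt_extChartAt

variable [LieGroup 𝓘(ℝ, E) ∞ G]

lemma hasMFDerivAt_mul_left (g x : G) :
    HasMFDerivAt 𝓘(ℝ, E) 𝓘(ℝ, E) (fun x : G => g * x) x
      (mfderiv 𝓘(ℝ, E) 𝓘(ℝ, E) (fun x : G => g * x) x) :=
  ((contMDiff_mul_left (I := 𝓘(ℝ, E)) (n := ∞)).mdifferentiable (by simp) x).hasMFDerivAt

lemma leftTangentInv_leftTangent (g : G) (ξ : E) : leftTangentInv g (leftTangent g ξ) = ξ := by
  have hcomp := (hasMFDerivAt_mul_left (E := E) g⁻¹ (g * 1)).comp (1 : G)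
    (hasMFDerivAt_mul_left g 1)
  have hid : (fun x : G => g⁻¹ * x) ∘ (fun x : G => g * x) = id := by ext x; simp
  rw [hid, mfderiv_congr_point (mul_one g)] at hcomp
  exact DFunLike.congr_fun (hasMFDerivAt_unique hcomp (hasMFDerivAt_id (I := 𝓘(ℝ, E)) (1 : G))) ξ

lemma leftTangent_leftTangentInv (g : G) (v : TangentSpace 𝓘(ℝ, E) g) :
    leftTangent g (leftTangentInv g v) = v := by
  have hcomp := (hasMFDerivAt_mul_left (E := E) g (g⁻¹ * g)).comp g (hasMFDerivAt_mul_left g⁻¹ g)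
  have hid : (fun x : G => g * x) ∘ (fun x : G => g⁻¹ * x) = id := by ext x; simp
  rw [hid, mfderiv_congr_point (inv_mul_cancel g)] at hcomp
  exact DFunLike.congr_fun (hasMFDerivAt_unique hcomp (hasMFDerivAt_id (I := 𝓘(ℝ, E)) g)) v

lemma hasMFDerivAt_extChartAt_one {y : G} (hy : y = 1) :
    HasMFDerivAt 𝓘(ℝ, E) 𝓘(ℝ, E) (extChartAt 𝓘(ℝ, E) (1 : G)) y (ContinuousLinearMap.id ℝ E) := by
  subst hy
  have : IsManifold 𝓘(ℝ, E) 1 G := .of_le (n := ∞) (by simp)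
  have hd := (mdifferentiableAt_extChartAt (I := 𝓘(ℝ, E)) (mem_chart_source E (1 : G))).hasMFDerivAt
  rwa [mfderiv_extChartAt_self] at hd

lemma hasMFDerivWithinAt_inv_mul {S : Set F} {c : F → G} {p : F}
    (hc : MDifferentiableWithinAt 𝓘(ℝ, F) 𝓘(ℝ, E) c S p) :
    HasMFDerivWithinAt 𝓘(ℝ, F) 𝓘(ℝ, E) (fun x => (c p)⁻¹ * c x) S p
      ((mfderiv 𝓘(ℝ, E) 𝓘(ℝ, E) (fun x : G => (c p)⁻¹ * x) (c p)).comp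
        (mfderivWithin 𝓘(ℝ, F) 𝓘(ℝ, E) c S p)) :=
  (hasMFDerivAt_mul_left (c p)⁻¹ (c p)).comp_hasMFDerivWithinAt p hc.hasMFDerivWithinAt

lemma hasFDerivWithinAt_extChartAt_inv_mul {S : Set F} {c : F → G} {p : F}
    (hc : MDifferentiableWithinAt 𝓘(ℝ, F) 𝓘(ℝ, E) c S p) :
    HasFDerivWithinAt (fun x => extChartAt 𝓘(ℝ, E) (1 : G) ((c p)⁻¹ * c x))
      (maurerCartan S c p) S p := by
  have hlog := (hasMFDerivAt_extChartAt_one (E := E) (inv_mul_cancel (c p)))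
    |>.comp_hasMFDerivWithinAt p (hasMFDerivWithinAt_inv_mul hc)
  exact hlog.hasFDerivWithinAt

lemma contDiffWithinAt_extChartAt_inv_mul {S : Set F} {c : F → G}
    (hc : ContMDiffOn 𝓘(ℝ, F) 𝓘(ℝ, E) ∞ c S) {p : F} (hp : p ∈ S) :
    ContDiffWithinAt ℝ ∞ (fun q : F × F => extChartAt 𝓘(ℝ, E) (1 : G) ((c q.1)⁻¹ * c q.2))
      (S ×ˢ S) (p, p) := by
  have hfst : ContMDiffWithinAt 𝓘(ℝ, F × F) 𝓘(ℝ, E) ∞ (fun q : F × F => c q.1) (S ×ˢ S) (p, p) :=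
    ContMDiffWithinAt.comp (p, p) (hc p hp) contDiff_fst.contMDiff.contMDiffAt.contMDiffWithinAt
      fun q hq => hq.1
  have hsnd : ContMDiffWithinAt 𝓘(ℝ, F × F) 𝓘(ℝ, E) ∞ (fun q : F × F => c q.2) (S ×ˢ S) (p, p) :=
    ContMDiffWithinAt.comp (p, p) (hc p hp) contDiff_snd.contMDiff.contMDiffAt.contMDiffWithinAt
      fun q hq => hq.2
  exact ((contMDiffAt_extChartAt_one (inv_mul_cancel (c p))).comp_contMDiffWithinAt (p, p)
    (hfst.inv.mul hsnd)).contDiffWithinAt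

lemma contDiffOn_maurerCartan {S : Set F} {c : F → G}
    (hc : ContMDiffOn 𝓘(ℝ, F) 𝓘(ℝ, E) ∞ c S) (hS : UniqueDiffOn ℝ S) :
    ContDiffOn ℝ ∞ (maurerCartan S c : F → F →L[ℝ] E) S := by
  have hc' : MDifferentiableOn 𝓘(ℝ, F) 𝓘(ℝ, E) c S := hc.mdifferentiableOn (by simp)
  refine ContDiffOn.congr (fun p hp => ?_) fun p hp =>
    ((hasFDerivWithinAt_extChartAt_inv_mul (hc' p hp)).fderivWithin (hS p hp)).symm
  exact ContDiffWithinAt.fderivWithin (g := id) (t := S)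
    (f := fun p x => extChartAt 𝓘(ℝ, E) (1 : G) ((c p)⁻¹ * c x))
    (contDiffWithinAt_extChartAt_inv_mul hc hp) contDiffWithinAt_id hS (by simp) hp
    fun _ h => h

lemma hasFDerivWithinAt_rep_comp {X : Type*} [NormedAddCommGroup X] [NormedSpace ℝ X]
    {ρ : G →* (X →L[ℝ] X)} (hρ : MDifferentiableAt 𝓘(ℝ, E) 𝓘(ℝ, X →L[ℝ] X) ρ 1)
    {S : Set F} {c : F → G} {p : F} (hc : MDifferentiableWithinAt 𝓘(ℝ, F) 𝓘(ℝ, E) c S p)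
    (hp : p ∈ S) :
    HasFDerivWithinAt (fun x => ρ (c x))
      ((ContinuousLinearMap.compL ℝ X X X (ρ (c p))).comp
        ((infRep (E := E) ρ).comp (maurerCartan S c p))) S p := by
  have hρ_one : ∀ y : G, y = 1 →
      HasMFDerivAt 𝓘(ℝ, E) 𝓘(ℝ, X →L[ℝ] X) ρ y (infRep ρ : E →L[ℝ] (X →L[ℝ] X)) := by
    rintro y rfl
    exact hρ.hasMFDerivAt
  have hinv_mul : HasFDerivWithinAt (fun x => ρ ((c p)⁻¹ * c x))
      ((infRep (E := E) ρ).comp (maurerCartan S c p)) S p :=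
    HasMFDerivWithinAt.hasFDerivWithinAt <|
      (hρ_one _ (inv_mul_cancel (c p))).comp_hasMFDerivWithinAt p (hasMFDerivWithinAt_inv_mul hc)
  refine ((ContinuousLinearMap.compL ℝ X X X (ρ (c p))).hasFDerivAt.comp_hasFDerivWithinAt p
    hinv_mul).congr' (fun x _ => ?_) hp
  simp only [Function.comp_apply, ContinuousLinearMap.compL_apply]
  rw [← ContinuousLinearMap.mul_def, ← map_mul, mul_inv_cancel_left]

end MaurerCartan

/-! ### The structure equation -/

section StructureEquation

variable {E : Type*} [NormedAddCommGroup E] [NormedSpace ℝ E]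
  {G : Type*} [TopologicalSpace G] [ChartedSpace E G]
  {F : Type*} [NormedAddCommGroup F] [NormedSpace ℝ F]
  {e : OpenPartialHomeomorph G E} {q : E}

lemma minSmoothness_le_infty (k : ℕ) : minSmoothness ℝ k ≤ (∞ : WithTop ℕ∞) := by
  rw [minSmoothness_of_isRCLikeNormedField]
  exact WithTop.coe_le_coe.2 le_top

lemma mdifferentiable_of_mem_maximalAtlas (he : e ∈ IsManifold.maximalAtlas 𝓘(ℝ, E) ∞ G) :
    e.MDifferentiable 𝓘(ℝ, E) 𝓘(ℝ, E) :=
  ⟨(contMDiffOn_of_mem_maximalAtlas he).mdifferentiableOn (by simp),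
    (contMDiffOn_symm_of_mem_maximalAtlas he).mdifferentiableOn (by simp)⟩

lemma mlieBracket_eq_lieBracket (V W : (x : E) → TangentSpace 𝓘(ℝ, E) x) (q : E) :
    VectorField.mlieBracket 𝓘(ℝ, E) V W q = VectorField.lieBracket ℝ V W q := by
  rw [← VectorField.mlieBracketWithin_univ, VectorField.mlieBracketWithin_eq_lieBracketWithin]
  exact congrFun VectorField.lieBracketWithin_univ q

variable [Group G]

/-- The left-invariant vector field on `G` with value `ξ` at the identity, in the coordinates of
the chart `e`. -/
def leftInvariantChartField (e : OpenPartialHomeomorph G E) (ξ : E) : E → E :=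
  VectorField.mpullback 𝓘(ℝ, E) 𝓘(ℝ, E) e.symm
    (mulInvariantVectorField (I := 𝓘(ℝ, E)) (G := G) ξ)

lemma eventually_maurerCartan_eq_chart (he : e ∈ IsManifold.maximalAtlas 𝓘(ℝ, E) ∞ G)
    {S : Set F} {c : F → G} (hc : ContMDiffOn 𝓘(ℝ, F) 𝓘(ℝ, E) ∞ c S) (hS : UniqueDiffOn ℝ S)
    {p : F} (hp : p ∈ S) (hcp : c p ∈ e.source) :
    ∀ᶠ x in 𝓝[S] p, maurerCartan (E := E) S c x =
      (maurerCartan e.target e.symm (e (c x))).comp (fderivWithin ℝ (e ∘ c) S x) := by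
  have hsource : ∀ x ∈ S, c x ∈ e.source → ∀ᶠ y in 𝓝[S] x, c y ∈ e.source := fun x hx hxe =>
    (hc x hx).continuousWithinAt.preimage_mem_nhdsWithin (e.open_source.mem_nhds hxe)
  filter_upwards [hsource p hp hcp, self_mem_nhdsWithin] with x hxe hx
  have hec : ContMDiffWithinAt 𝓘(ℝ, F) 𝓘(ℝ, E) ∞ (e ∘ c) S x :=
    (contMDiffAt_of_mem_maximalAtlas he hxe).comp_contMDiffWithinAt x (hc x hx)
  have hsymm := contMDiffOn_symm_of_mem_maximalAtlas he (e (c x)) (e.map_source hxe)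
  refine maurerCartan_comp (f := e ∘ c) (hsymm.mdifferentiableWithinAt (by simp))
    (hec.contDiffWithinAt.differentiableWithinAt (by simp)) hx (hS x hx) ?_ ?_
  · filter_upwards [hsource x hx hxe] with y hy using e.map_source hy
  · filter_upwards [hsource x hx hxe] with y hy using (e.left_inv hy).symm

variable [LieGroup 𝓘(ℝ, E) ∞ G]

lemma maurerCartan_leftInvariantChartField (he : e ∈ IsManifold.maximalAtlas 𝓘(ℝ, E) ∞ G)
    (hq : q ∈ e.target) (ξ : E) :
    maurerCartan e.target e.symm q (leftInvariantChartField e ξ q) = ξ := by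
  have hinv : (mfderiv 𝓘(ℝ, E) 𝓘(ℝ, E) e.symm q).IsInvertible :=
    ⟨(mdifferentiable_of_mem_maximalAtlas he).symm.mfderiv hq, rfl⟩
  have hpush : mfderiv 𝓘(ℝ, E) 𝓘(ℝ, E) e.symm q (leftInvariantChartField (E := E) e ξ q) =
      leftTangent (e.symm q) ξ :=
    hinv.self_apply_inverse _
  rw [maurerCartan_of_isOpen e.open_target e.symm hq]
  exact (congrArg (leftTangentInv (e.symm q)) hpush).trans (leftTangentInv_leftTangent _ ξ)

lemma isInvertible_maurerCartan_chart (he : e ∈ IsManifold.maximalAtlas 𝓘(ℝ, E) ∞ G)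
    (hq : q ∈ e.target) : (maurerCartan e.target e.symm q : E →L[ℝ] E).IsInvertible := by
  have hθ : (leftTangentInv (e.symm q) : E →L[ℝ] E).IsInvertible :=
    .of_inverse (g := leftTangent (e.symm q)) (ContinuousLinearMap.ext
      (leftTangentInv_leftTangent (e.symm q))) (ContinuousLinearMap.ext
      (leftTangent_leftTangentInv (e.symm q)))
  have hsymm : (mfderiv 𝓘(ℝ, E) 𝓘(ℝ, E) e.symm q : E →L[ℝ] E).IsInvertible :=
    ⟨(mdifferentiable_of_mem_maximalAtlas he).symm.mfderiv hq, rfl⟩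
  rw [maurerCartan_of_isOpen e.open_target e.symm hq]
  exact hθ.comp hsymm

lemma leftInvariantChartField_eq_inverse (he : e ∈ IsManifold.maximalAtlas 𝓘(ℝ, E) ∞ G)
    (hq : q ∈ e.target) (ξ : E) :
    leftInvariantChartField e ξ q =
      (maurerCartan e.target e.symm q : E →L[ℝ] E).inverse ξ := by
  conv_rhs => rw [← maurerCartan_leftInvariantChartField he hq ξ]
  exact ((isInvertible_maurerCartan_chart he hq).inverse_apply_self _).symm

lemma leftInvariantChartField_maurerCartan (he : e ∈ IsManifold.maximalAtlas 𝓘(ℝ, E) ∞ G)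
    (hq : q ∈ e.target) (v : E) :
    leftInvariantChartField e (maurerCartan e.target e.symm q v) q = v := by
  rw [leftInvariantChartField_eq_inverse he hq]
  exact (isInvertible_maurerCartan_chart he hq).inverse_apply_self v

lemma differentiableAt_maurerCartan_chart (he : e ∈ IsManifold.maximalAtlas 𝓘(ℝ, E) ∞ G)
    (hq : q ∈ e.target) :
    DifferentiableAt ℝ (maurerCartan e.target e.symm : E → E →L[ℝ] E) q :=
  ((contDiffOn_maurerCartan (contMDiffOn_symm_of_mem_maximalAtlas he)
    e.open_target.uniqueDiffOn).contDiffAt (e.open_target.mem_nhds hq)).differentiableAt (by simp)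

variable [FiniteDimensional ℝ E]

lemma differentiableAt_leftInvariantChartField
    (he : e ∈ IsManifold.maximalAtlas 𝓘(ℝ, E) ∞ G) (hq : q ∈ e.target) (ξ : E) :
    DifferentiableAt ℝ (leftInvariantChartField e ξ) q := by
  have : CompleteSpace E := FiniteDimensional.complete ℝ E
  have hinverse : DifferentiableAt ℝ
      (fun x => (maurerCartan e.target e.symm x : E →L[ℝ] E).inverse) q :=
    (((isInvertible_maurerCartan_chart he hq).contDiffAt_map_inverse (n := 1)).differentiableAt
      one_ne_zero).comp q (differentiableAt_maurerCartan_chart he hq)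
  refine (hinverse.clm_apply (differentiableAt_const ξ)).congr_of_eventuallyEq ?_
  filter_upwards [e.open_target.mem_nhds hq] with x hx
  exact leftInvariantChartField_eq_inverse he hx ξ

lemma fderiv_maurerCartan_leftInvariantChartField
    (he : e ∈ IsManifold.maximalAtlas 𝓘(ℝ, E) ∞ G) (hq : q ∈ e.target) (ξ v : E) :
    fderiv ℝ (maurerCartan e.target e.symm : E → E →L[ℝ] E) q v
        (leftInvariantChartField e ξ q) =
      -maurerCartan e.target e.symm q (fderiv ℝ (leftInvariantChartField e ξ) q v) := by
  have hprod := (differentiableAt_maurerCartan_chart he hq).hasFDerivAt.clm_apply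
    (differentiableAt_leftInvariantChartField he hq ξ).hasFDerivAt
  have hconst : HasFDerivAt
      (fun x => maurerCartan e.target e.symm x (leftInvariantChartField e ξ x))
      (0 : E →L[ℝ] E) q := by
    refine (hasFDerivAt_const ξ q).congr_of_eventuallyEq ?_
    filter_upwards [e.open_target.mem_nhds hq] with x hx
    exact maurerCartan_leftInvariantChartField he hx ξ
  refine eq_neg_of_add_eq_zero_right ?_
  exact DFunLike.congr_fun (hprod.unique hconst) v

lemma lieBracket_leftInvariantChartField
    (he : e ∈ IsManifold.maximalAtlas 𝓘(ℝ, E) ∞ G) (hq : q ∈ e.target) (ξ η : E) :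
    VectorField.lieBracket ℝ (leftInvariantChartField e ξ) (leftInvariantChartField e η) q =
      leftInvariantChartField e (ad G ξ η) q := by
  have : CompleteSpace E := FiniteDimensional.complete ℝ E
  have : LieGroup 𝓘(ℝ, E) (minSmoothness ℝ 3) G := .of_le (minSmoothness_le_infty 3)
  have hpull := VectorField.mpullback_mlieBracket (I := 𝓘(ℝ, E)) (I' := 𝓘(ℝ, E)) (n := ∞)
    (f := e.symm) (x₀ := q) (V := mulInvariantVectorField (I := 𝓘(ℝ, E)) (G := G) ξ)
    (W := mulInvariantVectorField (I := 𝓘(ℝ, E)) (G := G) η)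
    (mdifferentiableAt_mulInvariantVectorField _) (mdifferentiableAt_mulInvariantVectorField _)
    ((contMDiffOn_symm_of_mem_maximalAtlas he).contMDiffAt (e.open_target.mem_nhds hq))
    (minSmoothness_le_infty 2)
  rw [← mulInvariantVector_mlieBracket (I := 𝓘(ℝ, E)) (G := G) ξ η, mlieBracket_eq_lieBracket]
    at hpull
  exact hpull.symm

lemma structure_equation_chart (he : e ∈ IsManifold.maximalAtlas 𝓘(ℝ, E) ∞ G)
    (hq : q ∈ e.target) (v w : E) :
    fderiv ℝ (maurerCartan e.target e.symm : E → E →L[ℝ] E) q v w -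
        fderiv ℝ (maurerCartan e.target e.symm : E → E →L[ℝ] E) q w v =
      -ad G (maurerCartan e.target e.symm q v) (maurerCartan e.target e.symm q w) := by
  set ξ : E := maurerCartan e.target e.symm q v
  set η : E := maurerCartan e.target e.symm q w
  have hv : leftInvariantChartField e ξ q = v := leftInvariantChartField_maurerCartan he hq v
  have hw : leftInvariantChartField e η q = w := leftInvariantChartField_maurerCartan he hq w
  have hv_deriv := fderiv_maurerCartan_leftInvariantChartField he hq η v
  have hw_deriv := fderiv_maurerCartan_leftInvariantChartField he hq ξ w
  have hbracket := lieBracket_leftInvariantChartField he hq ξ η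
  rw [VectorField.lieBracket, hv, hw] at hbracket
  rw [hw] at hv_deriv
  rw [hv] at hw_deriv
  rw [hv_deriv, hw_deriv, ← maurerCartan_leftInvariantChartField he hq (ad G ξ η), ← hbracket,
    map_sub]
  abel

theorem structure_equation {S : Set F} {c : F → G} (hc : ContMDiffOn 𝓘(ℝ, F) 𝓘(ℝ, E) ∞ c S)
    (hS : UniqueDiffOn ℝ S) {p : F} (hp : p ∈ S) (hp' : p ∈ closure (interior S)) (a b : F) :
    fderivWithin ℝ (maurerCartan S c : F → F →L[ℝ] E) S p a b -
        fderivWithin ℝ (maurerCartan S c : F → F →L[ℝ] E) S p b a =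
      -ad G (maurerCartan S c p a) (maurerCartan S c p b) := by
  set e := chartAt E (c p)
  have he : e ∈ IsManifold.maximalAtlas 𝓘(ℝ, E) ∞ G := IsManifold.chart_mem_maximalAtlas _
  have hcp : c p ∈ e.source := mem_chart_source E (c p)
  set Q : F → E := e ∘ c
  have hQ : ContDiffWithinAt ℝ ∞ Q S p :=
    ((contMDiffAt_of_mem_maximalAtlas he hcp).comp_contMDiffWithinAt p (hc p hp)).contDiffWithinAt
  have hchart := eventually_maurerCartan_eq_chart he hc hS hp hcp
  have hDQ := ((hQ.fderivWithin_right (m := 1) hS (WithTop.coe_le_coe.2 le_top)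
    hp).differentiableWithinAt one_ne_zero).hasFDerivWithinAt
  have hderiv := (((differentiableAt_maurerCartan_chart he
    (e.map_source hcp)).hasFDerivAt.comp_hasFDerivWithinAt p
      (hQ.differentiableWithinAt (by simp)).hasFDerivWithinAt).clm_comp hDQ).congr_of_eventuallyEq
    hchart (hchart.self_of_nhdsWithin hp)
  have hsymm := (hQ.isSymmSndFDerivWithinAt (n := ∞) (minSmoothness_le_infty 2) hS hp' hp).eq a b
  rw [hderiv.fderivWithin (hS p hp), hchart.self_of_nhdsWithin hp]
  simp only [add_apply, ContinuousLinearMap.comp_apply,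
    ContinuousLinearMap.compL_apply, ContinuousLinearMap.flip_apply]
  rw [← structure_equation_chart he (e.map_source hcp), hsymm]
  simp only [Q]
  abel

end StructureEquation

/-! ### The fundamental lemma of the calculus of variations for a linear equation -/

section DuBoisReymond

variable {a b : ℝ}

lemma exists_antiderivative_of_continuousOn (hab : a ≤ b) {f : ℝ → ℝ}
    (hf : ContinuousOn f (Icc a b)) :
    ∃ F : ℝ → ℝ, F a = 0 ∧ ∀ t ∈ Icc a b, HasDerivWithinAt F (f t) (Icc a b) t := by
  have hext : Continuous (IccExtend hab (domRestrict (Icc a b) f)) :=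
    (continuousOn_iff_continuous_domRestrict.1 hf).Icc_extend'
  refine ⟨fun t => ∫ x in a..t, IccExtend hab (domRestrict (Icc a b) f) x, by simp,
    fun t ht => ?_⟩
  have hderiv := (hext.integral_hasStrictDerivAt a t).hasDerivAt.hasDerivWithinAt (s := Icc a b)
  rwa [IccExtend_of_mem hab _ ht] at hderiv

lemma deriv_eq_zero_of_nonneg_of_eq_endpoints (hab : a < b) {N n : ℝ → ℝ}
    (hN : ∀ t ∈ Icc a b, HasDerivWithinAt N (n t) (Icc a b) t) (hn : ∀ t ∈ Icc a b, 0 ≤ n t)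
    (hends : N a = N b) {t : ℝ} (ht : t ∈ Icc a b) : n t = 0 := by
  have hmono : MonotoneOn N (Icc a b) :=
    monotoneOn_of_hasDerivWithinAt_nonneg (convex_Icc a b)
      (fun x hx => (hN x hx).continuousWithinAt)
      (fun x hx => (hN x (interior_subset hx)).mono interior_subset)
      fun x hx => hn x (interior_subset hx)
  have hconst : ∀ x ∈ Icc a b, N x = N a := fun x hx =>
    le_antisymm ((hmono hx (right_mem_Icc.2 hab.le) hx.2).trans hends.ge)
      (hmono (left_mem_Icc.2 hab.le) hx hx.1)
  exact (uniqueDiffOn_Icc hab t ht).eq_deriv (Icc a b) (hN t ht)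
    ((hasDerivWithinAt_const t (Icc a b) (N a)).congr hconst (hconst t ht))

lemma exists_integratingFactor_solution (hab : a ≤ b) {c q : ℝ → ℝ}
    (hc : ContinuousOn c (Icc a b)) (hq : ContinuousOn q (Icc a b)) :
    ∃ C N : ℝ → ℝ, N a = 0 ∧
      (∀ t ∈ Icc a b, HasDerivWithinAt N (Real.exp (-C t) * q t) (Icc a b) t) ∧
      ∀ t ∈ Icc a b, HasDerivWithinAt (fun t => Real.exp (C t) * N t)
        (c t * (Real.exp (C t) * N t) + q t) (Icc a b) t := by
  obtain ⟨C, -, hC⟩ := exists_antiderivative_of_continuousOn hab hc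
  have hC_cont : ContinuousOn C (Icc a b) := fun t ht => (hC t ht).continuousWithinAt
  obtain ⟨N, hNa, hN⟩ := exists_antiderivative_of_continuousOn hab
    (f := fun t => Real.exp (-C t) * q t) (hC_cont.neg.rexp.mul hq)
  refine ⟨C, N, hNa, hN, fun t ht => ((hC t ht).exp.mul (hN t ht)).congr_deriv ?_⟩
  rw [← mul_assoc (Real.exp (C t)) (Real.exp (-C t)), ← Real.exp_add, add_neg_cancel, Real.exp_zero]
  ring

lemma eq_zero_of_linear_ode_endpoint_zero (hab : a < b) {c q : ℝ → ℝ}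
    (hc : ContinuousOn c (Icc a b)) (hq : ContinuousOn q (Icc a b)) (hq0 : ∀ t ∈ Icc a b, 0 ≤ q t)
    (hend : ∀ u : ℝ → ℝ, u a = 0 →
      (∀ t ∈ Icc a b, HasDerivWithinAt u (c t * u t + q t) (Icc a b) t) → u b = 0)
    {t : ℝ} (ht : t ∈ Icc a b) : q t = 0 := by
  obtain ⟨C, N, hNa, hN, hu⟩ := exists_integratingFactor_solution hab.le hc hq
  have hNb : N b = 0 := by
    have hub := hend (fun t => Real.exp (C t) * N t) (by simp [hNa]) hu
    exact (mul_eq_zero.1 hub).resolve_left (Real.exp_pos _).ne'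
  have hexp := deriv_eq_zero_of_nonneg_of_eq_endpoints hab hN
    (fun x hx => mul_nonneg (Real.exp_pos _).le (hq0 x hx)) (hNa.trans hNb.symm) ht
  exact (mul_eq_zero.1 hexp).resolve_left (Real.exp_pos _).ne'

lemma eq_zero_of_bump_mul_self_eq_zero (hab : a < b) {f : ℝ → ℝ} (hf : ContinuousOn f (Icc a b))
    (hzero : ∀ t ∈ Icc a b, (t - a) * (b - t) * f t * f t = 0) {t : ℝ} (ht : t ∈ Icc a b) :
    f t = 0 := by
  have hint : EqOn f (fun _ => 0) (Ioo a b) := fun x hx => by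
    simpa [(sub_pos.2 hx.1).ne', (sub_pos.2 hx.2).ne'] using hzero x (Ioo_subset_Icc_self hx)
  exact hint.of_subset_closure hf continuousOn_const Ioo_subset_Icc_self
    (closure_Ioo hab.ne).ge ht

variable {V : Type*} [NormedAddCommGroup V] [NormedSpace ℝ V]

theorem hasDerivWithinAt_of_forall_linear_ode_endpoint_zero (hab : a < b)
    {p r : ℝ → StrongDual ℝ V} {c : ℝ → ℝ} (hp : ContDiffOn ℝ ∞ p (Icc a b))
    (hr : ContDiffOn ℝ ∞ r (Icc a b)) (hc : ContDiffOn ℝ ∞ c (Icc a b))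
    (hend : ∀ η : ℝ → V, ContDiffOn ℝ ∞ η (Icc a b) → η a = 0 → η b = 0 →
      ∀ w : ℝ → ℝ, w a = 0 →
        (∀ t ∈ Icc a b, HasDerivWithinAt w
          (c t * w t + (p t (derivWithin η (Icc a b) t) + r t (η t))) (Icc a b) t) → w b = 0)
    {t : ℝ} (ht : t ∈ Icc a b) : HasDerivWithinAt p (r t + c t • p t) (Icc a b) t := by
  have hp' : ContDiffOn ℝ ∞ (derivWithin p (Icc a b)) (Icc a b) :=
    hp.derivWithin (uniqueDiffOn_Icc hab) (by simp)
  have hpd : ∀ t ∈ Icc a b, HasDerivWithinAt p (derivWithin p (Icc a b) t) (Icc a b) t :=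
    fun t ht => (hp.differentiableOn (by simp) t ht).hasDerivWithinAt
  suffices hv : ∀ v, r t v + c t * p t v - derivWithin p (Icc a b) t v = 0 from
    (hpd t ht).congr_deriv (ContinuousLinearMap.ext fun v => (sub_eq_zero.1 (hv v)).symm)
  intro v
  set f : ℝ → ℝ := fun t => r t v + c t * p t v - derivWithin p (Icc a b) t v
  have hf : ContDiffOn ℝ ∞ f (Icc a b) :=
    ((hr.clm_apply contDiffOn_const).add (hc.mul (hp.clm_apply contDiffOn_const))).sub
      (hp'.clm_apply contDiffOn_const)
  set φ : ℝ → ℝ := fun t => (t - a) * (b - t) * f t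
  have hφ : ContDiffOn ℝ ∞ φ (Icc a b) :=
    ((contDiff_id.sub contDiff_const).mul (contDiff_const.sub contDiff_id)).contDiffOn.mul hf
  have hη : ContDiffOn ℝ ∞ (fun t => φ t • v) (Icc a b) := hφ.smul contDiffOn_const
  refine eq_zero_of_bump_mul_self_eq_zero hab hf.continuousOn (fun s hs => ?_) ht
  refine eq_zero_of_linear_ode_endpoint_zero hab (q := fun t => φ t * f t) hc.continuousOn
    (hφ.continuousOn.mul hf.continuousOn) (fun x hx => ?_) (fun u hu hu' => ?_) hs
  · have hsq : φ x * f x = (x - a) * (b - x) * (f x * f x) := mul_assoc _ _ _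
    rw [hsq]
    exact mul_nonneg (mul_nonneg (sub_nonneg.2 hx.1) (sub_nonneg.2 hx.2)) (mul_self_nonneg _)
  · -- Integrating by parts, `u` is the solution `w` for the variation `φ v` minus `p (φ v)`.
    have hw := hend (fun t => φ t • v) hη (by simp [φ]) (by simp [φ])
      (fun t => p t (φ t • v) + u t) (by simp [φ, hu]) fun x hx => by
        refine (((hpd x hx).clm_apply ((hη.differentiableOn (by simp)) x hx).hasDerivWithinAt).add
          (hu' x hx)).congr_deriv ?_
        simp only [map_smul, smul_eq_mul, f]
        ring
    simpa [φ] using hw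

end DuBoisReymond

/-! ### The first variation of the action -/

lemma integral_lagrangian_eq_sub {E Y : Type*} [TopologicalSpace E] [TopologicalSpace Y]
    {ℓ : E → ℝ → Y → ℝ} {h : ℝ} {ξ : ℝ → E} {α : ℝ → Y} {z : ℝ → ℝ} (hh : 0 ≤ h)
    (hℓ : Continuous ↿ℓ) (hξ : ContinuousOn ξ (Icc 0 h)) (hα : ContinuousOn α (Icc 0 h))
    (hz : ∀ t ∈ Icc 0 h, HasDerivWithinAt z (ℓ (ξ t) (z t) (α t)) (Icc 0 h) t) :
    ∫ t in (0 : ℝ)..h, ℓ (ξ t) (z t) (α t) = z h - z 0 := by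
  have hzc : ContinuousOn z (Icc 0 h) := fun t ht => (hz t ht).continuousWithinAt
  refine intervalIntegral.integral_eq_sub_of_hasDerivAt_of_le hh hzc
    (fun t ht => (hz t (Ioo_subset_Icc_self ht)).hasDerivAt (Icc_mem_nhds ht.1 ht.2))
    (ContinuousOn.intervalIntegrable ?_)
  rw [uIcc_of_le hh]
  exact hℓ.comp_continuousOn (hξ.prodMk (hzc.prodMk hα))

section FirstVariation

variable {E : Type*} [NormedAddCommGroup E] [NormedSpace ℝ E]
  {Y : Type*} [NormedAddCommGroup Y] [NormedSpace ℝ Y] {ℓ : E → ℝ → Y → ℝ} {x : E} {y : ℝ} {β : Y}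

/-- The momentum `δℓ/δξ ∈ 𝔤*` of a Lagrangian `ℓ(ξ, z, α)`. -/
def momentum (ℓ : E → ℝ → Y → ℝ) (x : E) (y : ℝ) (β : Y) : StrongDual ℝ E :=
  fderiv ℝ (fun x => ℓ x y β) x

/-- The partial derivative `∂ℓ/∂z` of a Lagrangian `ℓ(ξ, z, α)` in the contact variable `z`. -/
def contactDeriv (ℓ : E → ℝ → Y → ℝ) (x : E) (y : ℝ) (β : Y) : ℝ :=
  deriv (fun y => ℓ x y β) y

/-- The partial differential of a Lagrangian `ℓ(ξ, z, α)` in the advected parameter `α`. For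
`α ∈ X*` it is an element of `X**`; `dualGradient` is the corresponding element of `X`. -/
def parameterDeriv (ℓ : E → ℝ → Y → ℝ) (x : E) (y : ℝ) (β : Y) : StrongDual ℝ Y :=
  fderiv ℝ (fun b => ℓ x y b) β

lemma momentum_eq_fderiv_comp_inl (hℓ : DifferentiableAt ℝ ↿ℓ (x, y, β)) :
    momentum ℓ x y β = (fderiv ℝ ↿ℓ (x, y, β)).comp (.inl ℝ E (ℝ × Y)) :=
  (hℓ.hasFDerivAt.comp (f := fun x => (x, y, β)) x (hasFDerivAt_prodMk_left x (y, β))).fderiv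

lemma contactDeriv_eq_fderiv_apply (hℓ : DifferentiableAt ℝ ↿ℓ (x, y, β)) :
    contactDeriv ℓ x y β = fderiv ℝ ↿ℓ (x, y, β) (0, 1, 0) :=
  (hℓ.hasFDerivAt.comp_hasDerivAt (f := fun y => (x, y, β)) y
    ((hasDerivAt_const y x).prodMk ((hasDerivAt_id y).prodMk (hasDerivAt_const y β)))).deriv

lemma parameterDeriv_eq_fderiv_comp_inr (hℓ : DifferentiableAt ℝ ↿ℓ (x, y, β)) :
    parameterDeriv ℓ x y β =
      (fderiv ℝ ↿ℓ (x, y, β)).comp ((ContinuousLinearMap.inr ℝ E (ℝ × Y)).comp (.inr ℝ ℝ Y)) :=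
  (hℓ.hasFDerivAt.comp (f := fun b => (x, y, b)) β
    ((hasFDerivAt_prodMk_right x (y, β)).comp β (hasFDerivAt_prodMk_right y β))).fderiv

lemma fderiv_uncurry_apply (hℓ : DifferentiableAt ℝ ↿ℓ (x, y, β)) (u : E) (r : ℝ) (v : Y) :
    fderiv ℝ ↿ℓ (x, y, β) (u, r, v) =
      momentum ℓ x y β u + r * contactDeriv ℓ x y β + parameterDeriv ℓ x y β v := by
  have hsplit : (u, r, v) =
      ((u, 0, 0) : E × ℝ × Y) + r • ((0, 1, 0) : E × ℝ × Y) + ((0, 0, v) : E × ℝ × Y) := by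
    simp
  rw [momentum_eq_fderiv_comp_inl hℓ, contactDeriv_eq_fderiv_apply hℓ,
    parameterDeriv_eq_fderiv_comp_inr hℓ, hsplit, map_add, map_add, map_smul]
  rfl

variable {m n : WithTop ℕ∞}

lemma contDiff_momentum (hℓ : ContDiff ℝ n ↿ℓ) (hmn : m + 1 ≤ n) :
    ContDiff ℝ m ↿(momentum ℓ) := by
  have hdiff : Differentiable ℝ ↿ℓ := hℓ.differentiable (fun hn => by simp [hn] at hmn)
  have heq : ↿(momentum ℓ) = _ := funext fun q => momentum_eq_fderiv_comp_inl (hdiff q)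
  exact heq ▸ (hℓ.fderiv_right hmn).clm_comp contDiff_const

lemma contDiff_contactDeriv (hℓ : ContDiff ℝ n ↿ℓ) (hmn : m + 1 ≤ n) :
    ContDiff ℝ m ↿(contactDeriv ℓ) := by
  have hdiff : Differentiable ℝ ↿ℓ := hℓ.differentiable (fun hn => by simp [hn] at hmn)
  have heq : ↿(contactDeriv ℓ) = _ := funext fun q => contactDeriv_eq_fderiv_apply (hdiff q)
  exact heq ▸ (hℓ.fderiv_right hmn).clm_apply contDiff_const

lemma contDiff_parameterDeriv (hℓ : ContDiff ℝ n ↿ℓ) (hmn : m + 1 ≤ n) :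
    ContDiff ℝ m ↿(parameterDeriv ℓ) := by
  have hdiff : Differentiable ℝ ↿ℓ := hℓ.differentiable (fun hn => by simp [hn] at hmn)
  have heq : ↿(parameterDeriv ℓ) = _ := funext fun q => parameterDeriv_eq_fderiv_comp_inr (hdiff q)
  exact heq ▸ (hℓ.fderiv_right hmn).clm_comp contDiff_const

/-- The domain `[0, h] × (-ε, ε)` of a variation `(t, s) ↦ c(t, s)`. -/
abbrev varDomain (h ε : ℝ) : Set (ℝ × ℝ) := Icc 0 h ×ˢ Ioo (-ε) ε

variable {h ε : ℝ} {ξ δξ : ℝ → E} {α δα : ℝ → Y} {z w : ℝ → ℝ} {Ξ : ℝ × ℝ → E} {A : ℝ × ℝ → Y}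
  {Z : ℝ × ℝ → ℝ}

lemma contDiffOn_lagrangian_along (hℓ : ContDiff ℝ n ↿ℓ) (hΞ : ContDiffOn ℝ n Ξ (varDomain h ε))
    (hA : ContDiffOn ℝ n A (varDomain h ε)) :
    ContDiffOn ℝ n (fun p : ℝ × ℝ × ℝ => ℓ (Ξ (p.1, p.2.1)) p.2.2 (A (p.1, p.2.1)))
      (paramDomain ℝ h ε) := by
  have hproj : ContDiffOn ℝ n (fun p : ℝ × ℝ × ℝ => (p.1, p.2.1)) (paramDomain ℝ h ε) := by
    fun_prop
  have hmaps : MapsTo (fun p : ℝ × ℝ × ℝ => (p.1, p.2.1)) (paramDomain ℝ h ε) (varDomain h ε) :=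
    fun p hp => ⟨hp.1, hp.2.1⟩
  exact hℓ.comp_contDiffOn ((hΞ.comp hproj hmaps).prodMk
    ((contDiff_snd.comp contDiff_snd).contDiffOn.prodMk (hA.comp hproj hmaps)))

lemma hasFDerivAt_lagrangian_along (hℓ : DifferentiableAt ℝ ↿ℓ (x, y, β)) {Ξ : ℝ → E} {A : ℝ → Y}
    {u : E} {v : Y} (hΞ : HasDerivAt Ξ u 0) (hA : HasDerivAt A v 0) (hΞ0 : Ξ 0 = x)
    (hA0 : A 0 = β) :
    HasFDerivAt (fun q : ℝ × ℝ => ℓ (Ξ q.1) q.2 (A q.1))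
      ((fderiv ℝ ↿ℓ (x, y, β)).comp (((ContinuousLinearMap.toSpanSingleton ℝ u).comp
        (.fst ℝ ℝ ℝ)).prod ((ContinuousLinearMap.snd ℝ ℝ ℝ).prod
          ((ContinuousLinearMap.toSpanSingleton ℝ v).comp (.fst ℝ ℝ ℝ))))) (0, y) := by
  subst hΞ0 hA0
  exact hℓ.hasFDerivAt.comp (f := fun q : ℝ × ℝ => (Ξ q.1, q.2, A q.1)) (0, y)
    ((hΞ.hasFDerivAt.comp (0, y) hasFDerivAt_fst).prodMk
      (hasFDerivAt_snd.prodMk (hA.hasFDerivAt.comp (0, y) hasFDerivAt_fst)))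

theorem hasDerivAt_solution_lagrangian_along (hℓ : ContDiff ℝ 1 ↿ℓ) (hh : 0 < h) (hε : 0 < ε)
    (hz : ∀ t ∈ Icc 0 h, HasDerivWithinAt z (ℓ (ξ t) (z t) (α t)) (Icc 0 h) t)
    (hΞ : ContDiffOn ℝ 1 Ξ (varDomain h ε)) (hA : ContDiffOn ℝ 1 A (varDomain h ε))
    (h0 : ∀ t ∈ Icc 0 h, Ξ (t, 0) = ξ t ∧ A (t, 0) = α t)
    (hδ : ∀ t ∈ Icc 0 h, HasDerivAt (fun s => Ξ (t, s)) (δξ t) 0 ∧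
      HasDerivAt (fun s => A (t, s)) (δα t) 0)
    (hZ : ∀ s ∈ Ioo (-ε) ε, Z (0, s) = z 0 ∧ ∀ t ∈ Icc 0 h,
      HasDerivWithinAt (fun τ => Z (τ, s)) (ℓ (Ξ (t, s)) (Z (t, s)) (A (t, s))) (Icc 0 h) t)
    (hw0 : w 0 = 0)
    (hw : ∀ t ∈ Icc 0 h, HasDerivWithinAt w (contactDeriv ℓ (ξ t) (z t) (α t) * w t +
      (momentum ℓ (ξ t) (z t) (α t) (δξ t) + parameterDeriv ℓ (ξ t) (z t) (α t) (δα t)))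
      (Icc 0 h) t) {t : ℝ} (ht : t ∈ Icc 0 h) :
    HasDerivAt (fun s => Z (t, s)) (w t) 0 := by
  have hdiff : Differentiable ℝ ↿ℓ := hℓ.differentiable (by simp)
  have hF := contDiffOn_lagrangian_along hℓ hΞ hA
  have hz' : ∀ t ∈ Icc 0 h, HasDerivWithinAt z (ℓ (Ξ (t, 0)) (z t) (A (t, 0))) (Icc 0 h) t :=
    fun t ht => by simpa only [(h0 t ht).1, (h0 t ht).2] using hz t ht
  obtain ⟨C, hC, hZz⟩ := exists_abs_solution_family_sub_le hh hε hF hz' hZ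
  refine hasDerivAt_solution_family hh hε hF hC
    (fun t ht => hasFDerivAt_lagrangian_along (hdiff _) (hδ t ht).1 (hδ t ht).2 (h0 t ht).1
      (h0 t ht).2) hz'
    (by filter_upwards [Ioo_mem_nhds (neg_lt_zero.2 hε) hε] using hZ) hZz
    (fun t ht => (hw t ht).congr_deriv ?_) hw0 ht
  simp only [ContinuousLinearMap.comp_apply, ContinuousLinearMap.prod_apply,
    ContinuousLinearMap.coe_fst', ContinuousLinearMap.coe_snd',
    ContinuousLinearMap.toSpanSingleton_apply, one_smul, fderiv_uncurry_apply (hdiff _)]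
  ring

/-- The action equals `z(h, s) - z(0)`, so its derivative is the final value of the linearized
solution `w`. -/
theorem hasDerivAt_action (hℓ : ContDiff ℝ 1 ↿ℓ) (hh : 0 < h) (hε : 0 < ε)
    (hz : ∀ t ∈ Icc 0 h, HasDerivWithinAt z (ℓ (ξ t) (z t) (α t)) (Icc 0 h) t)
    (hΞ : ContDiffOn ℝ 1 Ξ (varDomain h ε)) (hA : ContDiffOn ℝ 1 A (varDomain h ε))
    (h0 : ∀ t ∈ Icc 0 h, Ξ (t, 0) = ξ t ∧ A (t, 0) = α t)
    (hδ : ∀ t ∈ Icc 0 h, HasDerivAt (fun s => Ξ (t, s)) (δξ t) 0 ∧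
      HasDerivAt (fun s => A (t, s)) (δα t) 0)
    (hZ : ∀ s ∈ Ioo (-ε) ε, Z (0, s) = z 0 ∧ ∀ t ∈ Icc 0 h,
      HasDerivWithinAt (fun τ => Z (τ, s)) (ℓ (Ξ (t, s)) (Z (t, s)) (A (t, s))) (Icc 0 h) t)
    (hw0 : w 0 = 0)
    (hw : ∀ t ∈ Icc 0 h, HasDerivWithinAt w (contactDeriv ℓ (ξ t) (z t) (α t) * w t +
      (momentum ℓ (ξ t) (z t) (α t) (δξ t) + parameterDeriv ℓ (ξ t) (z t) (α t) (δα t)))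
      (Icc 0 h) t) :
    HasDerivAt (fun s => ∫ t in (0 : ℝ)..h, ℓ (Ξ (t, s)) (Z (t, s)) (A (t, s))) (w h) 0 := by
  have hZh := hasDerivAt_solution_lagrangian_along hℓ hh hε hz hΞ hA h0 hδ hZ hw0 hw
    (right_mem_Icc.2 hh.le)
  refine (hZh.sub_const (z 0)).congr_of_eventuallyEq ?_
  filter_upwards [Ioo_mem_nhds (neg_lt_zero.2 hε) hε] with s hs
  have hslice : ContinuousOn (fun t => (t, s)) (Icc 0 h) := by fun_prop
  have hmaps : MapsTo (fun t => (t, s)) (Icc 0 h) (varDomain h ε) := fun t ht => ⟨ht, hs⟩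
  rw [← (hZ s hs).1]
  exact integral_lagrangian_eq_sub hh.le hℓ.continuous (hΞ.continuousOn.comp hslice hmaps)
    (hA.continuousOn.comp hslice hmaps) (hZ s hs).2

end FirstVariation

/-! ### Reduction by left invariance -/

section Reduction

variable {E : Type*} [NormedAddCommGroup E] [NormedSpace ℝ E]
  {G : Type*} [TopologicalSpace G] [ChartedSpace E G] [Group G]
  {X : Type*} [NormedAddCommGroup X] [NormedSpace ℝ X]
  {L : TangentBundle 𝓘(ℝ, E) G → ℝ → StrongDual ℝ X → ℝ} {ρ : G →* (X →L[ℝ] X)}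

/-- Left invariance of the extended Lagrangian `L` on `TG × ℝ × X*`, where `G` acts on `X*` by the
representation dual to `ρ`. -/
def IsLeftInvariant (ρ : G →* (X →L[ℝ] X))
    (L : TangentBundle 𝓘(ℝ, E) G → ℝ → StrongDual ℝ X → ℝ) : Prop :=
  ∀ (g : G) (v : TangentBundle 𝓘(ℝ, E) G) (y : ℝ) (β : StrongDual ℝ X),
    L (tangentLift g v) y (dualRep ρ g β) = L v y β

lemma tangentLift_inv_self (g : G) (v : TangentSpace 𝓘(ℝ, E) g) :
    tangentLift g⁻¹ (⟨g, v⟩ : TangentBundle 𝓘(ℝ, E) G) =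
      ⟨(1 : G), leftTangentInv (E := E) g v⟩ := by
  have hcongr : ∀ x : G, x = 1 → ∀ u : E,
      (⟨x, u⟩ : TangentBundle 𝓘(ℝ, E) G) = ⟨(1 : G), u⟩ := by rintro x rfl u; rfl
  exact hcongr (g⁻¹ * g) (inv_mul_cancel g) (leftTangentInv g v)

lemma IsLeftInvariant.eq_reducedLagrangian (hinv : IsLeftInvariant ρ L) (g : G)
    (v : TangentSpace 𝓘(ℝ, E) g) (y : ℝ) (β : StrongDual ℝ X) :
    L ⟨g, v⟩ y β = reducedLagrangian L (leftTangentInv g v) y (β.comp (ρ g)) := by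
  rw [← hinv g⁻¹, tangentLift_inv_self, dualRep, inv_inv]
  rfl

lemma IsLeftInvariant.tangentCurve_eq (hinv : IsLeftInvariant ρ L) (h : ℝ) (g : ℝ → G) (t y : ℝ)
    (β : StrongDual ℝ X) :
    L (tangentCurve h g t) y β = reducedLagrangian L (bodyVelocity h g t) y (β.comp (ρ (g t))) :=
  hinv.eq_reducedLagrangian _ _ _ _

lemma bodyVelocity_eq_maurerCartan (h : ℝ) (g : ℝ → G) (t : ℝ) :
    (bodyVelocity h g t : E) = maurerCartan (Icc 0 h) g t 1 :=
  rfl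

lemma contMDiff_tangentSpace_one [IsManifold 𝓘(ℝ, E) 1 G] :
    ContMDiff 𝓘(ℝ, E) 𝓘(ℝ, E).tangent ∞
      (fun ξ : E => (⟨(1 : G), ξ⟩ : TangentBundle 𝓘(ℝ, E) G)) := by
  intro ξ
  rw [ModelWithCorners.tangent, Bundle.contMDiffAt_totalSpace]
  refine ⟨contMDiffAt_const, contMDiffAt_id.congr_of_eventuallyEq (.of_forall fun η => ?_)⟩
  change (trivializationAt E (TangentSpace 𝓘(ℝ, E)) (1 : G) ⟨(1 : G), η⟩).2 = η
  rw [TangentBundle.trivializationAt_apply]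
  exact tangentCoordChange_self (mem_extChartAt_source _)

lemma contDiff_reducedLagrangian [IsManifold 𝓘(ℝ, E) 1 G]
    (hL : ContMDiff (𝓘(ℝ, E).tangent.prod 𝓘(ℝ, ℝ × StrongDual ℝ X)) 𝓘(ℝ, ℝ) ∞
      (fun y : TangentBundle 𝓘(ℝ, E) G × (ℝ × StrongDual ℝ X) => L y.1 y.2.1 y.2.2)) :
    ContDiff ℝ ∞ ↿(reducedLagrangian L) := by
  have hone : ContMDiff 𝓘(ℝ, E × ℝ × StrongDual ℝ X) 𝓘(ℝ, E).tangent ∞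
      (fun y : E × ℝ × StrongDual ℝ X => (⟨(1 : G), y.1⟩ : TangentBundle 𝓘(ℝ, E) G)) :=
    contMDiff_tangentSpace_one.comp contDiff_fst.contMDiff
  exact contMDiff_iff_contDiff.1 (hL.comp (hone.prodMk contDiff_snd.contMDiff))

lemma infGenerator_apply (hρ : MDifferentiableAt 𝓘(ℝ, E) 𝓘(ℝ, X →L[ℝ] X) ρ 1) (x : X) (η : E) :
    infGenerator ρ x η = infRep ρ η x := by
  have heval := (ContinuousLinearMap.apply ℝ X x : (X →L[ℝ] X) →L[ℝ] X).hasFDerivAt (x := ρ 1)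
    |>.hasMFDerivAt.comp 1 hρ.hasMFDerivAt
  exact congrArg (fun A : E →L[ℝ] X => A η) heval.mfderiv

/-- The bilinear map `(α, η) ↦ -ρ'*_η α = α ∘ ρ'_η`, the variation of the advected parameter `α`
in the direction `η`. -/
def advection (ρ : G →* (X →L[ℝ] X)) : StrongDual ℝ X →L[ℝ] E →L[ℝ] StrongDual ℝ X :=
  ((ContinuousLinearMap.compL ℝ E (X →L[ℝ] X) (StrongDual ℝ X)).flip (infRep ρ)).comp
    (ContinuousLinearMap.compL ℝ X X ℝ)

lemma advection_apply (ρ : G →* (X →L[ℝ] X)) (α : StrongDual ℝ X) (η : E) :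
    advection ρ α η = α.comp (infRep ρ η) :=
  rfl

lemma advection_apply_eq_neg_infDualRep (ρ : G →* (X →L[ℝ] X)) (α : StrongDual ℝ X) (η : E) :
    advection ρ α η = -infDualRep ρ η α :=
  (neg_neg _).symm

lemma momentumMap_dualGradient [FiniteDimensional ℝ X]
    (hρ : MDifferentiableAt 𝓘(ℝ, E) 𝓘(ℝ, X →L[ℝ] X) ρ 1) (f : StrongDual ℝ X → ℝ)
    (α : StrongDual ℝ X) :
    (momentumMap ρ (dualGradient f α) α : StrongDual ℝ E) =
      (fderiv ℝ f α).comp (advection ρ α) := by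
  ext η
  calc momentumMap ρ (dualGradient f α) α η = α (infGenerator ρ (dualGradient f α) η) := rfl
    _ = advection ρ α η (dualGradient f α) := by rw [infGenerator_apply hρ, advection_apply]; rfl
    _ = fderiv ℝ f α (advection ρ α η) := apply_dualGradient f α _

section AdvectedParameter

variable {F : Type*} [NormedAddCommGroup F] [NormedSpace ℝ F] {S : Set F} {c : F → G}

lemma contDiffOn_dual_comp_rep {n : WithTop ℕ∞} (hρ : ContMDiff 𝓘(ℝ, E) 𝓘(ℝ, X →L[ℝ] X) n ρ)
    (hc : ContMDiffOn 𝓘(ℝ, F) 𝓘(ℝ, E) n c S) (α₀ : StrongDual ℝ X) :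
    ContDiffOn ℝ n (fun x => α₀.comp (ρ (c x))) S :=
  (ContinuousLinearMap.compL ℝ X X ℝ α₀).contDiff.comp_contDiffOn
    (contMDiffOn_iff_contDiffOn.1 (hρ.comp_contMDiffOn hc))

lemma hasFDerivWithinAt_dual_comp_rep [LieGroup 𝓘(ℝ, E) ∞ G]
    (hρ : MDifferentiableAt 𝓘(ℝ, E) 𝓘(ℝ, X →L[ℝ] X) ρ 1) {p : F}
    (hc : MDifferentiableWithinAt 𝓘(ℝ, F) 𝓘(ℝ, E) c S p) (hp : p ∈ S) (α₀ : StrongDual ℝ X) :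
    HasFDerivWithinAt (fun x => α₀.comp (ρ (c x)))
      ((advection ρ (α₀.comp (ρ (c p)))).comp (maurerCartan (E := E) S c p)) S p :=
  (ContinuousLinearMap.compL ℝ X X ℝ α₀).hasFDerivAt.comp_hasFDerivWithinAt p
    (hasFDerivWithinAt_rep_comp hρ hc hp)

end AdvectedParameter

lemma isLinearMap_ad [FiniteDimensional ℝ E] [LieGroup 𝓘(ℝ, E) ∞ G] :
    IsLinearMap ℝ (ad G : E → E →L[ℝ] E) := by
  have : CompleteSpace E := FiniteDimensional.complete ℝ E
  have : LieGroup 𝓘(ℝ, E) (minSmoothness ℝ 3) G :=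
    LieGroup.of_le (n := ∞) (minSmoothness_le_infty 3)
  exact ⟨fun ξ₁ ξ₂ => ContinuousLinearMap.ext fun η => add_lie (L := GroupLieAlgebra 𝓘(ℝ, E) G)
      (M := GroupLieAlgebra 𝓘(ℝ, E) G) ξ₁ ξ₂ η,
    fun r ξ => ContinuousLinearMap.ext fun η => smul_lie (R := ℝ)
      (L := GroupLieAlgebra 𝓘(ℝ, E) G) (M := GroupLieAlgebra 𝓘(ℝ, E) G) r ξ η⟩

lemma contDiff_ad [FiniteDimensional ℝ E] [LieGroup 𝓘(ℝ, E) ∞ G] {n : WithTop ℕ∞} :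
    ContDiff ℝ n (ad G : E → E →L[ℝ] E) :=
  (LinearMap.toContinuousLinearMap (isLinearMap_ad (G := G) (E := E)).mk').contDiff

end Reduction

/-! ### Momentum equations -/

section MomentumEquations

variable {E : Type*} [NormedAddCommGroup E] [NormedSpace ℝ E]
  {Y : Type*} [NormedAddCommGroup Y] [NormedSpace ℝ Y]

/-- The linear form `η ↦ ⟨δℓ/δξ, B_ξ η⟩ + ⟨δℓ/δα, N_α η⟩`. With `B = ad` and `N` the advection it
is the force `ad*_ξ δℓ/δξ + J_X(δℓ/δα, α)` of the Euler–Poincaré equations. -/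
def reducedForce (B : E → E →L[ℝ] E) (N : Y → E →L[ℝ] Y) (ℓ : E → ℝ → Y → ℝ) (x : E) (y : ℝ)
    (β : Y) : StrongDual ℝ E :=
  (momentum ℓ x y β).comp (B x) + (parameterDeriv ℓ x y β).comp (N β)

/-- The Herglotz-type equations `d/dt (δℓ/δξ) = force + (∂ℓ/∂z) δℓ/δξ` and `ż = ℓ` on `[0, h]`, the
common form to which all the equations of motion are reduced. -/
def MomentumEquations (B : E → E →L[ℝ] E) (N : Y → E →L[ℝ] Y) (ℓ : E → ℝ → Y → ℝ) (h : ℝ)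
    (ξ : ℝ → E) (z : ℝ → ℝ) (α : ℝ → Y) : Prop :=
  ∀ t ∈ Icc 0 h,
    HasDerivWithinAt (fun τ => momentum ℓ (ξ τ) (z τ) (α τ))
      (reducedForce B N ℓ (ξ t) (z t) (α t) +
        contactDeriv ℓ (ξ t) (z t) (α t) • momentum ℓ (ξ t) (z t) (α t)) (Icc 0 h) t ∧
    HasDerivWithinAt z (ℓ (ξ t) (z t) (α t)) (Icc 0 h) t

end MomentumEquations

/-! ### Variations of a curve in the group -/

section VarDomain

variable {W : Type*} [NormedAddCommGroup W] [NormedSpace ℝ W] {f : ℝ × ℝ → W}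
  {f' : ℝ × ℝ →L[ℝ] W} {h ε t s : ℝ}

lemma uniqueDiffOn_varDomain (hh : 0 < h) (ε : ℝ) : UniqueDiffOn ℝ (varDomain h ε) :=
  (uniqueDiffOn_Icc hh).prod isOpen_Ioo.uniqueDiffOn

lemma mem_closure_interior_varDomain (hh : 0 < h) (ht : t ∈ Icc 0 h) (hs : s ∈ Ioo (-ε) ε) :
    (t, s) ∈ closure (interior (varDomain h ε)) := by
  rw [interior_prod_eq, interior_Icc, isOpen_Ioo.interior_eq, closure_prod_eq, closure_Ioo hh.ne]
  exact ⟨ht, subset_closure hs⟩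

lemma hasDerivWithinAt_comp_time (hs : s ∈ Ioo (-ε) ε)
    (hf : HasFDerivWithinAt f f' (varDomain h ε) (t, s)) :
    HasDerivWithinAt (fun τ => f (τ, s)) (f' (1, 0)) (Icc 0 h) t :=
  hf.comp_hasDerivWithinAt (f := fun τ => (τ, s)) t
    ((hasDerivWithinAt_id _ _).prodMk (hasDerivWithinAt_const _ _ s)) fun _ hτ => ⟨hτ, hs⟩

lemma hasDerivAt_comp_param (ht : t ∈ Icc 0 h) (hs : s ∈ Ioo (-ε) ε)
    (hf : HasFDerivWithinAt f f' (varDomain h ε) (t, s)) :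
    HasDerivAt (fun σ => f (t, σ)) (f' (0, 1)) s :=
  (hf.comp_hasDerivWithinAt (f := fun σ => (t, σ)) s
    ((hasDerivWithinAt_const _ _ t).prodMk (hasDerivWithinAt_id s (Ioo (-ε) ε)))
    fun _ hσ => ⟨ht, hσ⟩).hasDerivAt (isOpen_Ioo.mem_nhds hs)

end VarDomain

section Variations

variable {E : Type*} [NormedAddCommGroup E] [NormedSpace ℝ E]
  {G : Type*} [TopologicalSpace G] [ChartedSpace E G]

/-- `c` is a smooth variation of the curve `g : [0, h] → G` with fixed endpoints, with parameter
`s ∈ (-ε, ε)`. -/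
structure IsVariation (E : Type*) [NormedAddCommGroup E] [NormedSpace ℝ E]
    {G : Type*} [TopologicalSpace G] [ChartedSpace E G] (h ε : ℝ) (c : ℝ × ℝ → G) (g : ℝ → G) :
    Prop where
  pos : 0 < ε
  contMDiffOn : ContMDiffOn 𝓘(ℝ, ℝ × ℝ) 𝓘(ℝ, E) ∞ c (varDomain h ε)
  apply_zero : ∀ t ∈ Icc 0 h, c (t, 0) = g t
  apply_endpoints : ∀ s ∈ Ioo (-ε) ε, c (0, s) = g 0 ∧ c (h, s) = g h

variable {h ε δ t s : ℝ} {c : ℝ × ℝ → G} {g : ℝ → G}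

namespace IsVariation

lemma zero_mem (hc : IsVariation E h ε c g) : (0 : ℝ) ∈ Ioo (-ε) ε :=
  ⟨neg_lt_zero.2 hc.pos, hc.pos⟩

lemma mono (hc : IsVariation E h ε c g) (hδ : 0 < δ) (hδε : δ ≤ ε) : IsVariation E h δ c g where
  pos := hδ
  contMDiffOn := hc.contMDiffOn.mono (prod_mono_right (Ioo_subset_Ioo (neg_le_neg hδε) hδε))
  apply_zero := hc.apply_zero
  apply_endpoints s hs := hc.apply_endpoints s (Ioo_subset_Ioo (neg_le_neg hδε) hδε hs)

lemma mdifferentiableOn (hc : IsVariation E h ε c g) :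
    MDifferentiableOn 𝓘(ℝ, ℝ × ℝ) 𝓘(ℝ, E) c (varDomain h ε) :=
  hc.contMDiffOn.mdifferentiableOn (by simp)

end IsVariation

variable [Group G]

/-- The left-trivialized velocities `c⁻¹ ∂c/∂t` of the curves of a variation. -/
def variationVelocity (h ε : ℝ) (c : ℝ × ℝ → G) (p : ℝ × ℝ) : E :=
  maurerCartan (varDomain h ε) c p (1, 0)

/-- The left-trivialized variational field `c⁻¹ ∂c/∂s` of a variation. -/
def variationField (h ε : ℝ) (c : ℝ × ℝ → G) (p : ℝ × ℝ) : E :=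
  maurerCartan (varDomain h ε) c p (0, 1)

namespace IsVariation

lemma variationField_mono (hh : 0 < h) (hc : IsVariation E h ε c g) (hδ : 0 < δ) (hδε : δ ≤ ε)
    (ht : t ∈ Icc 0 h) :
    (variationField h δ c (t, 0) : E) = variationField h ε c (t, 0) :=
  DFunLike.congr_fun (maurerCartan_mono
    (prod_mono_right (Ioo_subset_Ioo (neg_le_neg hδε) hδε))
    (hc.mdifferentiableOn _ ⟨ht, hc.zero_mem⟩)
    (uniqueDiffOn_varDomain hh δ _ ⟨ht, neg_lt_zero.2 hδ, hδ⟩)) (0, 1)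

lemma bodyVelocity_eq (hh : 0 < h) (hc : IsVariation E h ε c g) {γ : ℝ → G}
    (hs : s ∈ Ioo (-ε) ε) (hγ : ∀ τ ∈ Icc 0 h, γ τ = c (τ, s)) (ht : t ∈ Icc 0 h) :
    (bodyVelocity h γ t : E) = variationVelocity h ε c (t, s) := by
  have hslice : HasFDerivWithinAt (fun τ : ℝ => (τ, s)) (ContinuousLinearMap.inl ℝ ℝ ℝ)
      (Icc 0 h) t := (hasFDerivAt_prodMk_left t s).hasFDerivWithinAt
  have hU := uniqueDiffOn_Icc hh t ht
  rw [bodyVelocity_eq_maurerCartan, maurerCartan_comp (f := fun τ : ℝ => (τ, s))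
    (hc.mdifferentiableOn (t, s) ⟨ht, hs⟩) hslice.differentiableWithinAt ht hU
    (eventually_mem_nhdsWithin.mono fun τ hτ => ⟨hτ, hs⟩)
    (eventually_mem_nhdsWithin.mono hγ), hslice.fderivWithin hU]
  rfl

variable [LieGroup 𝓘(ℝ, E) ∞ G]

lemma contDiffOn_variationVelocity (hh : 0 < h) (hc : IsVariation E h ε c g) :
    ContDiffOn ℝ ∞ (variationVelocity h ε c : ℝ × ℝ → E) (varDomain h ε) :=
  (contDiffOn_maurerCartan hc.contMDiffOn (uniqueDiffOn_varDomain hh ε)).clm_apply contDiffOn_const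

lemma contDiffOn_variationField (hh : 0 < h) (hc : IsVariation E h ε c g) :
    ContDiffOn ℝ ∞ (fun t => (variationField h ε c (t, 0) : E)) (Icc 0 h) :=
  ((contDiffOn_maurerCartan hc.contMDiffOn (uniqueDiffOn_varDomain hh ε)).clm_apply
    contDiffOn_const).comp (contDiff_id.prodMk contDiff_const).contDiffOn
    fun _ ht => ⟨ht, hc.zero_mem⟩

lemma hasDerivAt_extChartAt_inv_mul (hc : IsVariation E h ε c g) (ht : t ∈ Icc 0 h) :
    HasDerivAt (fun s => extChartAt 𝓘(ℝ, E) (1 : G) ((g t)⁻¹ * c (t, s)))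
      (variationField h ε c (t, 0)) 0 := by
  have hlog := hasDerivAt_comp_param ht hc.zero_mem
    (hasFDerivWithinAt_extChartAt_inv_mul (hc.mdifferentiableOn (t, 0) ⟨ht, hc.zero_mem⟩))
  rwa [hc.apply_zero t ht] at hlog

lemma variationField_eq_zero (hc : IsVariation E h ε c g) (ht : t ∈ Icc 0 h)
    (hct : ∀ s ∈ Ioo (-ε) ε, c (t, s) = g t) : (variationField h ε c (t, 0) : E) = 0 := by
  refine (hc.hasDerivAt_extChartAt_inv_mul ht).unique
    ((hasDerivAt_const (0 : ℝ) (extChartAt 𝓘(ℝ, E) (1 : G) 1)).congr_of_eventuallyEq ?_)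
  filter_upwards [isOpen_Ioo.mem_nhds hc.zero_mem] with s hs
  rw [hct s hs, inv_mul_cancel]

lemma hasDerivAt_variationVelocity [FiniteDimensional ℝ E] (hh : 0 < h)
    (hc : IsVariation E h ε c g) (ht : t ∈ Icc 0 h) :
    HasDerivAt (fun s => (variationVelocity h ε c (t, s) : E))
      (derivWithin (fun τ => (variationField h ε c (τ, 0) : E)) (Icc 0 h) t +
        ad G (bodyVelocity h g t) (variationField h ε c (t, 0))) 0 := by
  have hp : (t, 0) ∈ varDomain h ε := ⟨ht, hc.zero_mem⟩
  have hU := uniqueDiffOn_varDomain hh ε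
  have hθ := ((contDiffOn_maurerCartan (E := E) hc.contMDiffOn hU).differentiableOn (by simp)
    (t, 0) hp).hasFDerivWithinAt
  have hparam := (hasDerivAt_comp_param ht hc.zero_mem hθ).clm_apply
    (hasDerivAt_const (0 : ℝ) ((1 : ℝ), (0 : ℝ)))
  have htime := (hasDerivWithinAt_comp_time hc.zero_mem hθ).clm_apply
    (hasDerivWithinAt_const t (Icc 0 h) ((0 : ℝ), (1 : ℝ)))
  have hMC := structure_equation hc.contMDiffOn hU hp
    (mem_closure_interior_varDomain hh ht hc.zero_mem) (1, 0) (0, 1)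
  have hcomm := htime.derivWithin (uniqueDiffOn_Icc hh t ht)
  rw [map_zero, add_zero] at hparam hcomm
  refine hparam.congr_deriv ?_
  rw [hc.bodyVelocity_eq hh hc.zero_mem (fun τ hτ => (hc.apply_zero τ hτ).symm) ht]
  simp only [variationVelocity, variationField]
  rw [hcomm, sub_eq_iff_eq_add.1 hMC]
  abel

end IsVariation

lemma exists_pos_forall_add_smul_mem {K : Set ℝ} (hK : IsCompact K) {η : ℝ → E}
    (hη : ContinuousOn η K) {U : Set E} {x : E} (hU : U ∈ 𝓝 x) :
    ∃ ε > (0 : ℝ), ∀ t ∈ K, ∀ s ∈ Ioo (-ε) ε, x + s • η t ∈ U := by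
  obtain ⟨r, hr, hball⟩ := Metric.mem_nhds_iff.1 hU
  obtain ⟨M, hM⟩ := hK.exists_bound_of_continuousOn hη
  have hM_pos : 0 < |M| + 1 := by positivity
  refine ⟨r / (|M| + 1), by positivity, fun t ht s hs => hball ?_⟩
  rw [mem_ball_iff_norm, add_sub_cancel_left, norm_smul, Real.norm_eq_abs]
  calc |s| * ‖η t‖ ≤ |s| * (|M| + 1) := by gcongr; linarith [hM t ht, le_abs_self M]
    _ < r := (lt_div_iff₀ hM_pos).1 (abs_lt.2 hs)

variable [LieGroup 𝓘(ℝ, E) ∞ G]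

lemma exists_isVariation_variationField_eq
    (hg : ContMDiffOn 𝓘(ℝ, ℝ) 𝓘(ℝ, E) ∞ g (Icc 0 h)) {η : ℝ → E}
    (hη : ContDiffOn ℝ ∞ η (Icc 0 h)) (hη0 : η 0 = 0) (hηh : η h = 0) :
    ∃ ε c, IsVariation E h ε c g ∧ ∀ t ∈ Icc 0 h, variationField h ε c (t, 0) = η t := by
  set φ := extChartAt 𝓘(ℝ, E) (1 : G)
  have hφ_one : φ.symm (φ 1) = 1 := extChartAt_to_inv (I := 𝓘(ℝ, E)) (1 : G)
  obtain ⟨ε, hε, hmem⟩ := exists_pos_forall_add_smul_mem isCompact_Icc hη.continuousOn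
    (extChartAt_target_mem_nhds (I := 𝓘(ℝ, E)) (1 : G))
  have hsmooth : ContMDiffOn 𝓘(ℝ, ℝ × ℝ) 𝓘(ℝ, E) ∞
      (fun p : ℝ × ℝ => g p.1 * φ.symm (φ 1 + p.2 • η p.1)) (varDomain h ε) := by
    have hgfst : ContMDiffOn 𝓘(ℝ, ℝ × ℝ) 𝓘(ℝ, E) ∞ (fun p : ℝ × ℝ => g p.1) (varDomain h ε) :=
      hg.comp contDiff_fst.contMDiff.contMDiffOn fun p hp => hp.1
    have hline : ContDiffOn ℝ ∞ (fun p : ℝ × ℝ => φ 1 + p.2 • η p.1) (varDomain h ε) :=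
      contDiffOn_const.add (contDiff_snd.contDiffOn.smul
        (hη.comp contDiff_fst.contDiffOn fun p hp => hp.1))
    exact hgfst.mul ((contMDiffOn_extChartAt_symm (1 : G)).comp hline.contMDiffOn
      fun p hp => hmem p.1 hp.1 p.2 hp.2)
  have hvar : IsVariation E h ε (fun p => g p.1 * φ.symm (φ 1 + p.2 • η p.1)) g :=
    { pos := hε
      contMDiffOn := hsmooth
      apply_zero := fun t _ => by simp [hφ_one]
      apply_endpoints := fun s _ => by simp [hη0, hηh, hφ_one] }
  refine ⟨ε, _, hvar, fun t ht => (hvar.hasDerivAt_extChartAt_inv_mul ht).unique ?_⟩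
  have hline : HasDerivAt (fun s : ℝ => φ 1 + s • η t) (η t) 0 := by
    simpa using ((hasDerivAt_id (0 : ℝ)).smul_const (η t)).const_add (φ 1)
  refine hline.congr_of_eventuallyEq ?_
  filter_upwards [isOpen_Ioo.mem_nhds hvar.zero_mem] with s hs
  rw [inv_mul_cancel_left]
  exact φ.right_inv (hmem t ht s hs)

end Variations

/-! ### Equivalence of the variational principles and the momentum equations -/

section Equivalences

variable {E : Type*} [NormedAddCommGroup E] [NormedSpace ℝ E]
  {G : Type*} [TopologicalSpace G] [ChartedSpace E G] [Group G]
  {X : Type*} [NormedAddCommGroup X] [NormedSpace ℝ X]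
  {ρ : G →* (X →L[ℝ] X)} {ℓ : E → ℝ → StrongDual ℝ X → ℝ} {h ε : ℝ}
  {L : TangentBundle 𝓘(ℝ, E) G → ℝ → StrongDual ℝ X → ℝ} {α₀ : StrongDual ℝ X}
  {g : ℝ → G} {c : ℝ × ℝ → G} {z w : ℝ → ℝ} {ξ : ℝ → E} {α : ℝ → StrongDual ℝ X} {Z : ℝ × ℝ → ℝ}

lemma IsLeftInvariant.variation_eq (hinv : IsLeftInvariant ρ L) (hh : 0 < h)
    (hc : IsVariation E h ε c g) {t s : ℝ} (ht : t ∈ Icc 0 h) (hs : s ∈ Ioo (-ε) ε) (y : ℝ)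
    (β : StrongDual ℝ X) :
    L (tangentCurve h (fun τ => c (τ, s)) t) y β =
      reducedLagrangian L (variationVelocity h ε c (t, s)) y (β.comp (ρ (c (t, s)))) := by
  rw [hinv.tangentCurve_eq, hc.bodyVelocity_eq hh hs (fun _ _ => rfl) ht]

lemma IsLeftInvariant.action_eventuallyEq (hinv : IsLeftInvariant ρ L) (hh : 0 < h)
    (hc : IsVariation E h ε c g) (Z : ℝ × ℝ → ℝ) (β : StrongDual ℝ X) :
    (fun s => ∫ t in (0 : ℝ)..h, L (tangentCurve h (fun τ => c (τ, s)) t) (Z (t, s)) β) =ᶠ[𝓝 0]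
      fun s => ∫ t in (0 : ℝ)..h, reducedLagrangian L (variationVelocity h ε c (t, s)) (Z (t, s))
        (β.comp (ρ (c (t, s)))) := by
  filter_upwards [isOpen_Ioo.mem_nhds hc.zero_mem] with s hs
  refine intervalIntegral.integral_congr fun t ht => ?_
  rw [uIcc_of_le hh.le] at ht
  exact hinv.variation_eq hh hc ht hs _ _

variable [LieGroup 𝓘(ℝ, E) ∞ G]

lemma IsVariation.hasDerivAt_dual_comp_rep (hρ : MDifferentiableAt 𝓘(ℝ, E) 𝓘(ℝ, X →L[ℝ] X) ρ 1)
    (hc : IsVariation E h ε c g) (α₀ : StrongDual ℝ X) {t : ℝ} (ht : t ∈ Icc 0 h) :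
    HasDerivAt (fun s => α₀.comp (ρ (c (t, s))))
      (advection ρ (α₀.comp (ρ (g t))) (variationField h ε c (t, 0) : E)) 0 := by
  have hp : (t, 0) ∈ varDomain h ε := ⟨ht, hc.zero_mem⟩
  have hderiv := hasDerivAt_comp_param ht hc.zero_mem
    (hasFDerivWithinAt_dual_comp_rep hρ (hc.mdifferentiableOn _ hp) hp α₀)
  rwa [hc.apply_zero t ht] at hderiv

lemma contDiffOn_bodyVelocity (hh : 0 < h) (hg : ContMDiffOn 𝓘(ℝ, ℝ) 𝓘(ℝ, E) ∞ g (Icc 0 h)) :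
    ContDiffOn ℝ ∞ (bodyVelocity h g : ℝ → E) (Icc 0 h) :=
  (contDiffOn_maurerCartan hg (uniqueDiffOn_Icc hh)).clm_apply contDiffOn_const

lemma contDiffOn_reducedCurve (hρ : ContMDiff 𝓘(ℝ, E) 𝓘(ℝ, X →L[ℝ] X) ∞ ρ) (hh : 0 < h)
    (hg : ContMDiffOn 𝓘(ℝ, ℝ) 𝓘(ℝ, E) ∞ g (Icc 0 h)) (hz : ContDiffOn ℝ ∞ z (Icc 0 h))
    (α₀ : StrongDual ℝ X) :
    ContDiffOn ℝ ∞ (fun t => ((bodyVelocity h g t : E), z t, α₀.comp (ρ (g t)))) (Icc 0 h) :=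
  (contDiffOn_bodyVelocity hh hg).prodMk (hz.prodMk (contDiffOn_dual_comp_rep hρ hg α₀))

lemma IsLeftInvariant.exists_solution_family (hinv : IsLeftInvariant ρ L)
    (hℓ : ContDiff ℝ ∞ ↿(reducedLagrangian L)) (hρ : ContMDiff 𝓘(ℝ, E) 𝓘(ℝ, X →L[ℝ] X) ∞ ρ)
    (hh : 0 < h) (hc : IsVariation E h ε c g)
    (hz : ∀ t ∈ Icc 0 h, HasDerivWithinAt z (L (tangentCurve h g t) (z t) α₀) (Icc 0 h) t) :
    ∃ (δ : ℝ) (Z : ℝ × ℝ → ℝ), 0 < δ ∧ δ ≤ ε ∧ ∀ s ∈ Ioo (-δ) δ, Z (0, s) = z 0 ∧ ∀ t ∈ Icc 0 h,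
      HasDerivWithinAt (fun τ => Z (τ, s)) (L (tangentCurve h (fun τ => c (τ, s)) t) (Z (t, s)) α₀)
        (Icc 0 h) t := by
  have hF := contDiffOn_lagrangian_along hℓ (hc.contDiffOn_variationVelocity hh)
    (contDiffOn_dual_comp_rep hρ hc.contMDiffOn α₀)
  have hz' : ∀ t ∈ Icc 0 h, HasDerivWithinAt z (reducedLagrangian L
      (variationVelocity h ε c (t, 0)) (z t) (α₀.comp (ρ (c (t, 0))))) (Icc 0 h) t := by
    intro t ht
    rw [hc.apply_zero t ht,
      ← hc.bodyVelocity_eq hh hc.zero_mem (fun τ hτ => (hc.apply_zero τ hτ).symm) ht,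
      ← hinv.tangentCurve_eq]
    exact hz t ht
  obtain ⟨δ, _, hδ, hδε, -, Z, hZ⟩ :=
    HerglotzReduction.exists_solution_family hh hc.pos (hF.of_le (by simp)) hz'
  refine ⟨δ, Z, hδ, hδε.le, fun s hs => ⟨(hZ s hs).1, fun t ht => ?_⟩⟩
  rw [hinv.variation_eq hh hc ht (Ioo_subset_Ioo (neg_le_neg hδε.le) hδε.le hs)]
  exact ((hZ s hs).2 t ht).1

variable [FiniteDimensional ℝ E]

theorem eulerPoincareHerglotzEquations_iff [FiniteDimensional ℝ X]
    (hρ : MDifferentiableAt 𝓘(ℝ, E) 𝓘(ℝ, X →L[ℝ] X) ρ 1)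
    (hg : MDifferentiableOn 𝓘(ℝ, ℝ) 𝓘(ℝ, E) g (Icc 0 h)) :
    EulerPoincareHerglotzEquations ρ ℓ h (g 0) α₀ (bodyVelocity h g) z
        (fun t => α₀.comp (ρ (g t))) ↔
      MomentumEquations (ad G) (advection ρ) ℓ h (bodyVelocity h g) z
        (fun t => α₀.comp (ρ (g t))) := by
  have hα : ∀ t ∈ Icc 0 h, HasDerivWithinAt (fun t => α₀.comp (ρ (g t)))
      (-infDualRep ρ (bodyVelocity h g t : E) (α₀.comp (ρ (g t)))) (Icc 0 h) t := fun t ht =>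
    (hasFDerivWithinAt_dual_comp_rep hρ (hg t ht) ht α₀).hasDerivWithinAt.congr_deriv
      (advection_apply_eq_neg_infDualRep ρ _ _)
  have hα_zero : α₀.comp (ρ (g 0)) = dualRep ρ (g 0)⁻¹ α₀ := by rw [dualRep, inv_inv]
  simp only [EulerPoincareHerglotzEquations, momentumMap_dualGradient hρ]
  exact ⟨fun H t ht => ⟨(H.2 t ht).1, (H.2 t ht).2.2⟩,
    fun H => ⟨hα_zero, fun t ht => ⟨(H t ht).1, hα t ht, (H t ht).2⟩⟩⟩

/-- The pairing of the momentum with `η` solves the linearized contact equation and vanishes at both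
endpoints, so the first variation of the action is zero. -/
theorem reducedPrinciple_of_momentumEquations (hℓ : ContDiff ℝ 1 ↿ℓ) (hh : 0 < h)
    (H : MomentumEquations (ad G) (advection ρ) ℓ h ξ z α) : ReducedPrinciple ρ ℓ h ξ z α := by
  refine ⟨fun t ht => (H t ht).2, fun ε Ξ A Z η hε hΞ hA hη hη0 hηh h0 hδ hZ => ?_⟩
  have hw : ∀ t ∈ Icc 0 h, HasDerivWithinAt (fun τ => momentum ℓ (ξ τ) (z τ) (α τ) (η τ))
      (contactDeriv ℓ (ξ t) (z t) (α t) * momentum ℓ (ξ t) (z t) (α t) (η t) +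
        (momentum ℓ (ξ t) (z t) (α t) (derivWithin η (Icc 0 h) t + ad G (ξ t) (η t)) +
          parameterDeriv ℓ (ξ t) (z t) (α t) (-infDualRep ρ (η t) (α t)))) (Icc 0 h) t := by
    intro t ht
    have hη' := (hη.differentiableOn (by simp) t ht).hasDerivWithinAt
    refine ((H t ht).1.clm_apply hη').congr_deriv ?_
    simp only [reducedForce, add_apply, smul_apply, ContinuousLinearMap.comp_apply,
      ← advection_apply_eq_neg_infDualRep, map_add, smul_eq_mul]
    ring
  have haction := hasDerivAt_action hℓ hh hε (fun t ht => (H t ht).2) (hΞ.of_le (by simp))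
    (hA.of_le (by simp)) h0 hδ hZ (by simp [hη0]) hw
  simpa [hηh] using haction

theorem herglotzPrinciple_of_reducedPrinciple (hρ : ContMDiff 𝓘(ℝ, E) 𝓘(ℝ, X →L[ℝ] X) ∞ ρ)
    (hinv : IsLeftInvariant ρ L) (hh : 0 < h)
    (H : ReducedPrinciple ρ (reducedLagrangian L) h (bodyVelocity h g) z
      (fun t => α₀.comp (ρ (g t)))) :
    HerglotzPrinciple (fun v y => L v y α₀) h g z := by
  refine ⟨fun t ht => (H.1 t ht).congr_deriv (hinv.tangentCurve_eq h g t _ _).symm,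
    fun ε c Z hε hc hc0 hcE hZ => ?_⟩
  have hvar : IsVariation E h ε c g := ⟨hε, hc, hc0, hcE⟩
  refine HasDerivAt.congr_of_eventuallyEq ?_ (hinv.action_eventuallyEq hh hvar Z α₀)
  refine H.2 ε (variationVelocity h ε c) (fun p => α₀.comp (ρ (c p))) Z
    (fun t => variationField h ε c (t, 0)) hε (hvar.contDiffOn_variationVelocity hh)
    (contDiffOn_dual_comp_rep hρ hc α₀) (hvar.contDiffOn_variationField hh)
    (hvar.variationField_eq_zero (left_mem_Icc.2 hh.le) fun s hs => (hcE s hs).1)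
    (hvar.variationField_eq_zero (right_mem_Icc.2 hh.le) fun s hs => (hcE s hs).2)
    (fun t ht => ⟨(hvar.bodyVelocity_eq hh hvar.zero_mem (fun τ hτ => (hc0 τ hτ).symm) ht).symm,
      by rw [hc0 t ht]⟩)
    (fun t ht => ⟨hvar.hasDerivAt_variationVelocity hh ht, ?_⟩)
    (fun s hs => ⟨(hZ s hs).1, fun t ht => ((hZ s hs).2 t ht).congr_deriv
      (hinv.variation_eq hh hvar ht hs _ _)⟩)
  rw [← advection_apply_eq_neg_infDualRep]
  exact hvar.hasDerivAt_dual_comp_rep (hρ.mdifferentiable (by simp) 1) α₀ ht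

lemma IsLeftInvariant.hasDerivAt_action_variation (hinv : IsLeftInvariant ρ L)
    (hℓ : ContDiff ℝ 1 ↿(reducedLagrangian L)) (hρ : ContMDiff 𝓘(ℝ, E) 𝓘(ℝ, X →L[ℝ] X) ∞ ρ)
    (hh : 0 < h) (hc : IsVariation E h ε c g)
    (hξ : ∀ t ∈ Icc 0 h, bodyVelocity h g t = ξ t) (hα : ∀ t ∈ Icc 0 h, α₀.comp (ρ (g t)) = α t)
    {η : ℝ → E} (hη : ∀ t ∈ Icc 0 h, variationField h ε c (t, 0) = η t)
    (hz : ∀ t ∈ Icc 0 h,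
      HasDerivWithinAt z (reducedLagrangian L (ξ t) (z t) (α t)) (Icc 0 h) t)
    (hZ : ∀ s ∈ Ioo (-ε) ε, Z (0, s) = z 0 ∧ ∀ t ∈ Icc 0 h, HasDerivWithinAt (fun τ => Z (τ, s))
      (L (tangentCurve h (fun τ => c (τ, s)) t) (Z (t, s)) α₀) (Icc 0 h) t)
    (hw0 : w 0 = 0)
    (hw : ∀ t ∈ Icc 0 h, HasDerivWithinAt w
      (contactDeriv (reducedLagrangian L) (ξ t) (z t) (α t) * w t +
        (momentum (reducedLagrangian L) (ξ t) (z t) (α t) (derivWithin η (Icc 0 h) t) +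
          reducedForce (ad G) (advection ρ) (reducedLagrangian L) (ξ t) (z t) (α t) (η t)))
      (Icc 0 h) t) :
    HasDerivAt (fun s => ∫ t in (0 : ℝ)..h,
      L (tangentCurve h (fun τ => c (τ, s)) t) (Z (t, s)) α₀) (w h) 0 := by
  refine HasDerivAt.congr_of_eventuallyEq ?_ (hinv.action_eventuallyEq hh hc Z α₀)
  refine hasDerivAt_action (δξ := fun t => derivWithin η (Icc 0 h) t + ad G (ξ t) (η t))
    (δα := fun t => advection ρ (α t) (η t)) hℓ hh hc.pos hz
    ((hc.contDiffOn_variationVelocity hh).of_le (by simp))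
    ((contDiffOn_dual_comp_rep hρ hc.contMDiffOn α₀).of_le (by simp))
    (fun t ht => ⟨?_, ?_⟩) (fun t ht => ⟨?_, ?_⟩)
    (fun s hs => ⟨(hZ s hs).1, fun t ht => ((hZ s hs).2 t ht).congr_deriv
      (hinv.variation_eq hh hc ht hs _ _)⟩) hw0 (fun t ht => (hw t ht).congr_deriv ?_)
  · rw [← hξ t ht,
      hc.bodyVelocity_eq hh hc.zero_mem (fun τ hτ => (hc.apply_zero τ hτ).symm) ht]
  · rw [← hα t ht, hc.apply_zero t ht]
  · have hvel := hc.hasDerivAt_variationVelocity hh ht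
    rwa [hη t ht, derivWithin_congr hη (hη t ht), hξ t ht] at hvel
  · have hadv := hc.hasDerivAt_dual_comp_rep (hρ.mdifferentiable (by simp) 1) α₀ ht
    rwa [hη t ht, hα t ht] at hadv
  · simp only [reducedForce, add_apply, ContinuousLinearMap.comp_apply, map_add]
    ring

theorem momentumEquations_of_herglotzPrinciple (hρ : ContMDiff 𝓘(ℝ, E) 𝓘(ℝ, X →L[ℝ] X) ∞ ρ)
    (hℓ : ContDiff ℝ ∞ ↿(reducedLagrangian L)) (hinv : IsLeftInvariant ρ L) (hh : 0 < h)
    (hg : ContMDiffOn 𝓘(ℝ, ℝ) 𝓘(ℝ, E) ∞ g (Icc 0 h)) (hz : ContDiffOn ℝ ∞ z (Icc 0 h))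
    (H : HerglotzPrinciple (fun v y => L v y α₀) h g z) :
    MomentumEquations (ad G) (advection ρ) (reducedLagrangian L) h (bodyVelocity h g) z
      (fun t => α₀.comp (ρ (g t))) := by
  have hz' : ∀ t ∈ Icc 0 h, HasDerivWithinAt z (reducedLagrangian L (bodyVelocity h g t) (z t)
      (α₀.comp (ρ (g t)))) (Icc 0 h) t := fun t ht =>
    (H.1 t ht).congr_deriv (hinv.tangentCurve_eq h g t _ _)
  have hcurve := contDiffOn_reducedCurve hρ hh hg hz α₀
  have hp := (contDiff_momentum hℓ (m := ∞) (by simp)).comp_contDiffOn hcurve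
  have hforce := (hp.clm_comp ((contDiff_ad (G := G) (E := E)).comp_contDiffOn
    (contDiffOn_bodyVelocity hh hg))).add
      (((contDiff_parameterDeriv hℓ (m := ∞) (by simp)).comp_contDiffOn hcurve).clm_comp
        ((advection ρ).contDiff.comp_contDiffOn (contDiffOn_dual_comp_rep hρ hg α₀)))
  refine fun t ht => ⟨hasDerivWithinAt_of_forall_linear_ode_endpoint_zero hh hp hforce
    ((contDiff_contactDeriv hℓ (m := ∞) (by simp)).comp_contDiffOn hcurve)
    (fun η hη hη0 hηh w hw0 hw => ?_) ht, hz' t ht⟩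
  obtain ⟨ε, c, hc, hcη⟩ := exists_isVariation_variationField_eq hg hη hη0 hηh
  obtain ⟨δ, Z, hδ, hδε, hZ⟩ := hinv.exists_solution_family hℓ hρ hh hc H.1
  have hc' := hc.mono hδ hδε
  have haction := hinv.hasDerivAt_action_variation (hℓ.of_le (by simp)) hρ hh hc'
    (fun _ _ => rfl) (fun _ _ => rfl)
    (fun t ht => (hc.variationField_mono hh hδ hδε ht).trans (hcη t ht)) hz' hZ hw0 hw
  exact haction.unique
    (H.2 δ c Z hδ hc'.contMDiffOn hc'.apply_zero hc'.apply_endpoints hZ)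

end Equivalences

/-! ### Hamel's equations in quasi-velocities -/

lemma hasDerivWithinAt_iff_eq {V : Type*} [NormedAddCommGroup V] [NormedSpace ℝ V] {f : ℝ → V}
    {f' v : V} {S : Set ℝ} {t : ℝ} (hf : HasDerivWithinAt f f' S t)
    (hS : UniqueDiffWithinAt ℝ S t) : HasDerivWithinAt f v S t ↔ f' = v :=
  ⟨hS.eq_deriv S hf, fun hv => hv ▸ hf⟩

/-- The Herglotz equation `d/dt (∂L/∂q̇) = ∂L/∂q + (∂L/∂z) ∂L/∂q̇` at time `t`, for a Lagrangian
`L(q, q̇, z)` on a vector space and a curve `q` defined on `S`. -/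
def HerglotzEquationAt {Q : Type*} [NormedAddCommGroup Q] [NormedSpace ℝ Q] (L : Q → Q → ℝ → ℝ)
    (S : Set ℝ) (q : ℝ → Q) (z : ℝ → ℝ) (t : ℝ) : Prop :=
  HasDerivWithinAt (fun τ => fderiv ℝ (fun v => L (q τ) v (z τ)) (derivWithin q S τ))
    (fderiv ℝ (fun x => L x (derivWithin q S t) (z t)) (q t) +
      deriv (fun y => L (q t) (derivWithin q S t) y) (z t) •
        fderiv ℝ (fun v => L (q t) v (z t)) (derivWithin q S t)) S t

lemma herglotzEquationAt_congr {Q : Type*} [NormedAddCommGroup Q] [NormedSpace ℝ Q]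
    {L₁ L₂ : Q → Q → ℝ → ℝ} {U : Set Q} (hU : IsOpen U) (hL : ∀ x ∈ U, L₁ x = L₂ x) {S : Set ℝ}
    {q : ℝ → Q} {z : ℝ → ℝ} {t : ℝ} (ht : t ∈ S) (hq : ContinuousWithinAt q S t) (hqt : q t ∈ U) :
    HerglotzEquationAt L₁ S q z t ↔ HerglotzEquationAt L₂ S q z t := by
  have hvelocity : (fun τ => fderiv ℝ (fun v => L₁ (q τ) v (z τ)) (derivWithin q S τ)) =ᶠ[𝓝[S] t]
      fun τ => fderiv ℝ (fun v => L₂ (q τ) v (z τ)) (derivWithin q S τ) := by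
    filter_upwards [hq.preimage_mem_nhdsWithin (hU.mem_nhds hqt)] with τ hτ
    rw [hL _ hτ]
  have hposition : fderiv ℝ (fun x => L₁ x (derivWithin q S t) (z t)) (q t) =
      fderiv ℝ (fun x => L₂ x (derivWithin q S t) (z t)) (q t) := by
    refine Filter.EventuallyEq.fderiv_eq ?_
    filter_upwards [hU.mem_nhds hqt] with x hx
    rw [hL x hx]
  rw [HerglotzEquationAt, HerglotzEquationAt, hvelocity.hasDerivWithinAt_iff_of_mem ht, hposition,
    hL _ hqt]

section QuasiVelocity

variable {E : Type*} [NormedAddCommGroup E] [NormedSpace ℝ E]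
  {Q : Type*} [NormedAddCommGroup Q] [NormedSpace ℝ Q]
  {Y : Type*} {ℓ : E → ℝ → Y → ℝ} {Λ : Q → Q →L[ℝ] E} {β : Q → Y} {x v : Q} {y : ℝ}

/-- The Lagrangian `(q, v, z) ↦ ℓ(Λ_q v, z, β(q))` obtained from `ℓ` by using `ξ = Λ_q v` as
quasi-velocity and `α = β(q)` as parameter. -/
def quasiVelocityLagrangian (ℓ : E → ℝ → Y → ℝ) (Λ : Q → Q →L[ℝ] E) (β : Q → Y) (x v : Q)
    (y : ℝ) : ℝ :=
  ℓ (Λ x v) y (β x)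

lemma fderiv_quasiVelocityLagrangian_velocity
    (hℓ : DifferentiableAt ℝ (fun u => ℓ u y (β x)) (Λ x v)) :
    fderiv ℝ (fun v => quasiVelocityLagrangian ℓ Λ β x v y) v =
      (momentum ℓ (Λ x v) y (β x)).comp (Λ x) :=
  (hℓ.hasFDerivAt.comp v (Λ x).hasFDerivAt).fderiv

variable [NormedAddCommGroup Y] [NormedSpace ℝ Y]

lemma fderiv_quasiVelocityLagrangian_position (hℓ : DifferentiableAt ℝ ↿ℓ (Λ x v, y, β x))
    {β' : Q →L[ℝ] Y} (hΛ : DifferentiableAt ℝ Λ x) (hβ : HasFDerivAt β β' x) (u : Q) :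
    fderiv ℝ (fun x => quasiVelocityLagrangian ℓ Λ β x v y) x u =
      momentum ℓ (Λ x v) y (β x) (fderiv ℝ Λ x u v) + parameterDeriv ℓ (Λ x v) y (β x) (β' u) := by
  have hderiv := hℓ.hasFDerivAt.comp (f := fun x => (Λ x v, y, β x)) x
    ((hΛ.hasFDerivAt.clm_apply (hasFDerivAt_const v x)).prodMk
      ((hasFDerivAt_const y x).prodMk hβ))
  rw [show fderiv ℝ (fun x => quasiVelocityLagrangian ℓ Λ β x v y) x = _ from hderiv.fderiv]
  simp [fderiv_uncurry_apply hℓ]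

variable {B : E → E →L[ℝ] E} {N : Y → E →L[ℝ] Y} {S : Set ℝ} {t : ℝ} {q : ℝ → Q} {z : ℝ → ℝ}

lemma momentum_comp_fderiv_quasiVelocityLagrangian (hℓ : DifferentiableAt ℝ ↿ℓ (Λ x v, y, β x))
    (hΛ : DifferentiableAt ℝ Λ x) (hβ : HasFDerivAt β ((N (β x)).comp (Λ x)) x)
    (hB : ∀ u, fderiv ℝ Λ x v u - fderiv ℝ Λ x u v = -B (Λ x v) (Λ x u)) :
    (momentum ℓ (Λ x v) y (β x)).comp (fderiv ℝ Λ x v) =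
      fderiv ℝ (fun x => quasiVelocityLagrangian ℓ Λ β x v y) x -
        (reducedForce B N ℓ (Λ x v) y (β x)).comp (Λ x) := by
  ext u
  simp only [sub_apply, ContinuousLinearMap.comp_apply, reducedForce, add_apply,
    fderiv_quasiVelocityLagrangian_position hℓ hΛ hβ, sub_eq_iff_eq_add.1 (hB u), map_add, map_neg]
  ring

/-- Since `Λ` is invertible, `d/dt (p ∘ Λ_q) = p' ∘ Λ_q + p ∘ DΛ_q(q̇)` determines `p'`, and the
structure equation turns `p ∘ DΛ_q(q̇)` into the difference of the two forces. -/
theorem herglotzEquationAt_quasiVelocityLagrangian_iff (hℓ : Differentiable ℝ ↿ℓ)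
    (hS : UniqueDiffWithinAt ℝ S t) (hq : DifferentiableWithinAt ℝ q S t)
    (hΛ : DifferentiableAt ℝ Λ (q t)) (hinv : (Λ (q t)).IsInvertible)
    (hp : DifferentiableWithinAt ℝ
      (fun τ => momentum ℓ (Λ (q τ) (derivWithin q S τ)) (z τ) (β (q τ))) S t)
    (hβ : HasFDerivAt β ((N (β (q t))).comp (Λ (q t))) (q t))
    (hB : ∀ v u, fderiv ℝ Λ (q t) v u - fderiv ℝ Λ (q t) u v = -B (Λ (q t) v) (Λ (q t) u)) :
    HerglotzEquationAt (quasiVelocityLagrangian ℓ Λ β) S q z t ↔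
      HasDerivWithinAt (fun τ => momentum ℓ (Λ (q τ) (derivWithin q S τ)) (z τ) (β (q τ)))
        (reducedForce B N ℓ (Λ (q t) (derivWithin q S t)) (z t) (β (q t)) +
          contactDeriv ℓ (Λ (q t) (derivWithin q S t)) (z t) (β (q t)) •
            momentum ℓ (Λ (q t) (derivWithin q S t)) (z t) (β (q t))) S t := by
  rw [HerglotzEquationAt]
  set q' := derivWithin q S
  set p := fun τ => momentum ℓ (Λ (q τ) (q' τ)) (z τ) (β (q τ))
  set R := reducedForce B N ℓ (Λ (q t) (q' t)) (z t) (β (q t))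
  set σ := contactDeriv ℓ (Λ (q t) (q' t)) (z t) (β (q t))
  set f := fderiv ℝ (fun x => quasiVelocityLagrangian ℓ Λ β x (q' t) (z t)) (q t)
  have hmomentum : ∀ τ, fderiv ℝ (fun v => quasiVelocityLagrangian ℓ Λ β (q τ) v (z τ)) (q' τ) =
      (p τ).comp (Λ (q τ)) := fun τ => fderiv_quasiVelocityLagrangian_velocity
    ((hℓ _).comp (f := fun u => (u, z τ, β (q τ))) _ (by fun_prop))
  have hderiv : HasDerivWithinAt (fun τ => (p τ).comp (Λ (q τ)))
      ((derivWithin p S t).comp (Λ (q t)) + (f - R.comp (Λ (q t)))) S t :=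
    (hp.hasDerivWithinAt.clm_comp (hΛ.hasFDerivAt.comp_hasDerivWithinAt t
      hq.hasDerivWithinAt)).congr_deriv (congrArg _
        (momentum_comp_fderiv_quasiVelocityLagrangian (hℓ _) hΛ hβ (hB (q' t))))
  have hcomp_inj : Function.Injective fun A : StrongDual ℝ E => A.comp (Λ (q t)) :=
    fun A₁ A₂ hA => ContinuousLinearMap.coe_inj.1 ((LinearMap.cancel_right hinv.surjective).1
      (congrArg ContinuousLinearMap.toLinearMap hA))
  simp only [hmomentum]
  calc HasDerivWithinAt (fun τ => (p τ).comp (Λ (q τ))) (f + σ • (p t).comp (Λ (q t))) S t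
    _ ↔ (derivWithin p S t).comp (Λ (q t)) + (f - R.comp (Λ (q t))) =
          f + σ • (p t).comp (Λ (q t)) := hasDerivWithinAt_iff_eq hderiv hS
    _ ↔ (derivWithin p S t).comp (Λ (q t)) = (R + σ • p t).comp (Λ (q t)) := by
        rw [ContinuousLinearMap.add_comp, ContinuousLinearMap.smul_comp, add_sub_left_comm,
          add_right_inj, sub_eq_iff_eq_add']
    _ ↔ HasDerivWithinAt p (R + σ • p t) S t :=
        hcomp_inj.eq_iff.trans (hasDerivWithinAt_iff_eq hp.hasDerivWithinAt hS).symm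

end QuasiVelocity

/-! ### The Herglotz equations in charts and in the left trivialization -/

section LocalEquations

variable {E : Type*} [NormedAddCommGroup E] [NormedSpace ℝ E]
  {G : Type*} [TopologicalSpace G] [ChartedSpace E G] [Group G]
  {X : Type*} [NormedAddCommGroup X] [NormedSpace ℝ X]
  {ρ : G →* (X →L[ℝ] X)} {h t : ℝ} {L : TangentBundle 𝓘(ℝ, E) G → ℝ → StrongDual ℝ X → ℝ}
  {α₀ : StrongDual ℝ X} {g : ℝ → G} {z : ℝ → ℝ} {e : OpenPartialHomeomorph G E}

lemma IsLeftInvariant.chartLagrangian_eq (hinv : IsLeftInvariant ρ L) (α₀ : StrongDual ℝ X)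
    {q : E} (hq : q ∈ e.target) :
    chartLagrangian (fun v y => L v y α₀) e q =
      quasiVelocityLagrangian (reducedLagrangian L) (maurerCartan e.target e.symm)
        (fun x => α₀.comp (ρ (e.symm x))) q := by
  funext v y
  rw [chartLagrangian, hinv.eq_reducedLagrangian, quasiVelocityLagrangian,
    maurerCartan_of_isOpen e.open_target _ hq]
  rfl

lemma eventually_chart_quasiVelocity_eq (he : e ∈ IsManifold.maximalAtlas 𝓘(ℝ, E) ∞ G)
    (hh : 0 < h) (hg : ContMDiffOn 𝓘(ℝ, ℝ) 𝓘(ℝ, E) ∞ g (Icc 0 h)) (ht : t ∈ Icc 0 h)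
    (hgt : g t ∈ e.source) :
    ∀ᶠ τ in 𝓝[Icc 0 h] t,
      (maurerCartan e.target e.symm (e (g τ)) (derivWithin (e ∘ g) (Icc 0 h) τ) : E) =
        bodyVelocity h g τ := by
  filter_upwards [eventually_maurerCartan_eq_chart he hg (uniqueDiffOn_Icc hh) ht hgt] with τ hτ
  rw [bodyVelocity_eq_maurerCartan, hτ]
  rfl

variable [LieGroup 𝓘(ℝ, E) ∞ G]

section Translation

variable {W : Type*} [NormedAddCommGroup W] [NormedSpace ℝ W] {x : G}
  {f' : TangentSpace 𝓘(ℝ, E) x →L[ℝ] W}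

lemma hasMFDerivAt_comp_mul_left {f : G → W} (hf : HasMFDerivAt 𝓘(ℝ, E) 𝓘(ℝ, W) f x f') :
    HasMFDerivAt 𝓘(ℝ, E) 𝓘(ℝ, W) (fun y => f (x * y)) 1 (f'.comp (leftTangent (E := E) x)) := by
  have hf_mul_one : ∀ y : G, y = x → HasMFDerivAt 𝓘(ℝ, E) 𝓘(ℝ, W) f y (f' : E →L[ℝ] W) := by
    rintro y rfl
    exact hf
  exact (hf_mul_one _ (mul_one x)).comp 1 (hasMFDerivAt_mul_left x 1)

lemma comp_leftTangent_eq_of_hasMFDerivAt (hρ : MDifferentiableAt 𝓘(ℝ, E) 𝓘(ℝ, X →L[ℝ] X) ρ 1)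
    {f : StrongDual ℝ X → W} (hf : DifferentiableAt ℝ f (α₀.comp (ρ x)))
    (hf' : HasMFDerivAt 𝓘(ℝ, E) 𝓘(ℝ, W) (fun y => f (α₀.comp (ρ y))) x f') :
    f'.comp (leftTangent x) =
      (fderiv ℝ f (α₀.comp (ρ x))).comp (advection ρ (α₀.comp (ρ x))) := by
  set α := α₀.comp (ρ x)
  have hα_one : α.comp (ρ 1) = α := by rw [map_one]; rfl
  have hα : HasMFDerivAt 𝓘(ℝ, E) 𝓘(ℝ, StrongDual ℝ X) (fun y => α.comp (ρ y)) 1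
      (advection ρ α : E →L[ℝ] StrongDual ℝ X) :=
    (ContinuousLinearMap.compL ℝ X X ℝ α).hasFDerivAt.hasMFDerivAt.comp 1 hρ.hasMFDerivAt
  have hcomp : (fun y => f (α.comp (ρ y))) = fun y => f (α₀.comp (ρ (x * y))) := by
    funext y
    rw [map_mul, ContinuousLinearMap.mul_def, ← ContinuousLinearMap.comp_assoc]
  have hfα : HasFDerivAt f (fderiv ℝ f α) (α.comp (ρ 1)) := by
    rw [hα_one]
    exact hf.hasFDerivAt
  have hderiv := hfα.hasMFDerivAt.comp 1 hα
  exact hasMFDerivAt_unique (hasMFDerivAt_comp_mul_left hf') (hcomp ▸ hderiv)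

end Translation

variable [FiniteDimensional ℝ E]

theorem herglotzEquationAt_chartLagrangian_iff
    (hρ : ContMDiff 𝓘(ℝ, E) 𝓘(ℝ, X →L[ℝ] X) ∞ ρ) (hℓ : ContDiff ℝ ∞ ↿(reducedLagrangian L))
    (hinv : IsLeftInvariant ρ L) (hh : 0 < h)
    (hg : ContMDiffOn 𝓘(ℝ, ℝ) 𝓘(ℝ, E) ∞ g (Icc 0 h)) (hz : ContDiffOn ℝ ∞ z (Icc 0 h))
    (he : e ∈ IsManifold.maximalAtlas 𝓘(ℝ, E) ∞ G) (ht : t ∈ Icc 0 h) (hgt : g t ∈ e.source) :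
    HerglotzEquationAt (chartLagrangian (fun v y => L v y α₀) e) (Icc 0 h) (e ∘ g) z t ↔
      HasDerivWithinAt
        (fun τ => momentum (reducedLagrangian L) (bodyVelocity h g τ) (z τ) (α₀.comp (ρ (g τ))))
        (reducedForce (ad G) (advection ρ) (reducedLagrangian L) (bodyVelocity h g t) (z t)
            (α₀.comp (ρ (g t))) +
          contactDeriv (reducedLagrangian L) (bodyVelocity h g t) (z t) (α₀.comp (ρ (g t))) •
            momentum (reducedLagrangian L) (bodyVelocity h g t) (z t) (α₀.comp (ρ (g t))))
        (Icc 0 h) t := by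
  have hqt : (e ∘ g) t ∈ e.target := e.map_source hgt
  have hq : ContDiffWithinAt ℝ ∞ (e ∘ g) (Icc 0 h) t :=
    ((contMDiffAt_of_mem_maximalAtlas he hgt).comp_contMDiffWithinAt t (hg t ht)).contDiffWithinAt
  have hsource := (hg t ht).continuousWithinAt.preimage_mem_nhdsWithin (e.open_source.mem_nhds hgt)
  have hmomentum : (fun τ => momentum (reducedLagrangian L)
      (maurerCartan e.target e.symm ((e ∘ g) τ) (derivWithin (e ∘ g) (Icc 0 h) τ)) (z τ)
        (α₀.comp (ρ (e.symm ((e ∘ g) τ))))) =ᶠ[𝓝[Icc 0 h] t]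
      fun τ => momentum (reducedLagrangian L) (bodyVelocity h g τ) (z τ) (α₀.comp (ρ (g τ))) := by
    filter_upwards [eventually_chart_quasiVelocity_eq he hh hg ht hgt, hsource] with τ hτ hτe
    rw [Function.comp_apply, hτ, e.left_inv hτe]
  have hp := (((contDiff_momentum hℓ (m := ∞) (by simp)).comp_contDiffOn
    (contDiffOn_reducedCurve hρ hh hg hz α₀)).differentiableOn (by simp) t ht)
  have hβ : HasFDerivAt (fun x => α₀.comp (ρ (e.symm x)))
      ((advection ρ (α₀.comp (ρ (e.symm ((e ∘ g) t))))).comp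
        (maurerCartan e.target e.symm ((e ∘ g) t))) ((e ∘ g) t) :=
    (hasFDerivWithinAt_dual_comp_rep (hρ.mdifferentiable (by simp) 1)
      ((mdifferentiable_of_mem_maximalAtlas he).symm.1 _ hqt) hqt α₀).hasFDerivAt
        (e.open_target.mem_nhds hqt)
  rw [herglotzEquationAt_congr e.open_target (fun x hx => hinv.chartLagrangian_eq α₀ hx) ht
      hq.continuousWithinAt hqt,
    herglotzEquationAt_quasiVelocityLagrangian_iff (hℓ.differentiable (by simp))
      (uniqueDiffOn_Icc hh t ht) (hq.differentiableWithinAt (by simp))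
      (differentiableAt_maurerCartan_chart he hqt) (isInvertible_maurerCartan_chart he hqt)
      (hp.congr_of_eventuallyEq_of_mem hmomentum ht) hβ (structure_equation_chart he hqt),
    hmomentum.hasDerivWithinAt_iff_of_mem ht, Function.comp_apply, e.left_inv hgt,
    (eventually_chart_quasiVelocity_eq he hh hg ht hgt).self_of_nhdsWithin ht]

theorem herglotzEquations_iff (hρ : ContMDiff 𝓘(ℝ, E) 𝓘(ℝ, X →L[ℝ] X) ∞ ρ)
    (hℓ : ContDiff ℝ ∞ ↿(reducedLagrangian L)) (hinv : IsLeftInvariant ρ L) (hh : 0 < h)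
    (hg : ContMDiffOn 𝓘(ℝ, ℝ) 𝓘(ℝ, E) ∞ g (Icc 0 h)) (hz : ContDiffOn ℝ ∞ z (Icc 0 h)) :
    HerglotzEquations (fun v y => L v y α₀) h g z ↔
      MomentumEquations (ad G) (advection ρ) (reducedLagrangian L) h (bodyVelocity h g) z
        (fun t => α₀.comp (ρ (g t))) := by
  have hchart := fun {e : OpenPartialHomeomorph G E} he {t : ℝ} =>
    herglotzEquationAt_chartLagrangian_iff (α₀ := α₀) (e := e) (t := t) hρ hℓ hinv hh hg hz he
  have hcontact : ∀ t, L (tangentCurve h g t) (z t) α₀ =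
      reducedLagrangian L (bodyVelocity h g t) (z t) (α₀.comp (ρ (g t))) := fun t =>
    hinv.tangentCurve_eq h g t _ _
  simp only [HerglotzEquations, hcontact]
  exact ⟨fun H t ht => ⟨(hchart (IsManifold.chart_mem_maximalAtlas _) ht
      (mem_chart_source E (g t))).1 (H.1 _ (IsManifold.chart_mem_maximalAtlas _) t ht
        (mem_chart_source E (g t))), H.2 t ht⟩,
    fun H => ⟨fun e he t ht hgt => (hchart he ht hgt).2 (H t ht).1, fun t ht => (H t ht).2⟩⟩

theorem trivializedHerglotzEquations_iff (hρ : MDifferentiable 𝓘(ℝ, E) 𝓘(ℝ, X →L[ℝ] X) ρ)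
    (hℓ : Differentiable ℝ ↿(reducedLagrangian L)) (hinv : IsLeftInvariant ρ L) :
    TrivializedHerglotzEquations (fun v y => L v y α₀) h g z ↔
      MomentumEquations (ad G) (advection ρ) (reducedLagrangian L) h (bodyVelocity h g) z
        (fun t => α₀.comp (ρ (g t))) := by
  have htriv : ∀ x ξ y, trivializedLagrangian (fun v y => L v y α₀) x ξ y =
      reducedLagrangian L ξ y (α₀.comp (ρ x)) := fun x ξ y => by
    rw [trivializedLagrangian, hinv.eq_reducedLagrangian, leftTangentInv_leftTangent]
  have hreconstruct : ∀ t, velocity (E := E) h g t = leftTangent (g t) (bodyVelocity h g t) :=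
    fun t => (leftTangent_leftTangentInv _ _).symm
  refine forall₂_congr fun t _ => ?_
  set ℓ_t : StrongDual ℝ X → ℝ := reducedLagrangian L (bodyVelocity h g t) (z t)
  have hℓ_t : Differentiable ℝ ℓ_t := fun β =>
    (hℓ _).comp (f := fun β => ((bodyVelocity h g t : E), z t, β)) _ (by fun_prop)
  have hℓ_comp : MDifferentiableAt 𝓘(ℝ, E) 𝓘(ℝ, ℝ) (fun x => ℓ_t (α₀.comp (ρ x))) (g t) :=
    (hℓ_t _).mdifferentiableAt.comp (g t)
      ((ContinuousLinearMap.compL ℝ X X ℝ α₀).differentiableAt.mdifferentiableAt.comp (g t)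
        (hρ _))
  have hderiv : ∀ F : G → ℝ, F = (fun x => ℓ_t (α₀.comp (ρ x))) →
      HasMFDerivAt 𝓘(ℝ, E) 𝓘(ℝ, ℝ) (fun x => ℓ_t (α₀.comp (ρ x))) (g t)
        (mfderiv 𝓘(ℝ, E) 𝓘(ℝ, ℝ) F (g t)) := by
    rintro _ rfl
    exact hℓ_comp.hasMFDerivAt
  have hforce := comp_leftTangent_eq_of_hasMFDerivAt (hρ 1) (hℓ_t _)
    (hderiv _ (funext fun x => htriv x (bodyVelocity h g t) (z t)))
  dsimp only
  rw [hforce]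
  simp only [htriv]
  exact ⟨fun H => ⟨H.1, H.2.2⟩, fun H => ⟨H.1, hreconstruct t, H.2⟩⟩

end LocalEquations

end

end HerglotzReduction

theorem mainTheorem8
    {E : Type*} [NormedAddCommGroup E] [NormedSpace ℝ E] [FiniteDimensional ℝ E]
    {G : Type*} [TopologicalSpace G] [ChartedSpace E G] [Group G] [LieGroup 𝓘(ℝ, E) ∞ G]
    {X : Type*} [NormedAddCommGroup X] [NormedSpace ℝ X] [FiniteDimensional ℝ X]
    (ρ : G →* (X →L[ℝ] X)) (hρ : ContMDiff 𝓘(ℝ, E) 𝓘(ℝ, X →L[ℝ] X) ∞ ρ)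
    (Lext : TangentBundle 𝓘(ℝ, E) G → ℝ → StrongDual ℝ X → ℝ)
    (hL : ContMDiff (𝓘(ℝ, E).tangent.prod 𝓘(ℝ, ℝ × StrongDual ℝ X)) 𝓘(ℝ, ℝ) ∞
      (fun y : TangentBundle 𝓘(ℝ, E) G × (ℝ × StrongDual ℝ X) => Lext y.1 y.2.1 y.2.2))
    (hinv : ∀ (g : G) (v : TangentBundle 𝓘(ℝ, E) G) (w : ℝ) (β : StrongDual ℝ X),
      Lext (HerglotzReduction.tangentLift g v) w (HerglotzReduction.dualRep ρ g β) = Lext v w β)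
    (α₀ : StrongDual ℝ X) (h : ℝ) (hh : 0 < h)
    (g : ℝ → G) (hg : ContMDiffOn 𝓘(ℝ, ℝ) 𝓘(ℝ, E) ∞ g (Icc 0 h))
    (z : ℝ → ℝ) (hz : ContDiffOn ℝ ∞ z (Icc 0 h))
    (L₀ : TangentBundle 𝓘(ℝ, E) G → ℝ → ℝ) (hL₀ : ∀ v w, L₀ v w = Lext v w α₀)
    (ξ : ℝ → E) (hξ : ∀ t, ξ t = HerglotzReduction.bodyVelocity h g t)
    (α : ℝ → StrongDual ℝ X) (hα : ∀ t, α t = HerglotzReduction.dualRep ρ (g t)⁻¹ α₀) :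
    List.TFAE [
      HerglotzReduction.HerglotzPrinciple L₀ h g z,
      HerglotzReduction.HerglotzEquations L₀ h g z,
      HerglotzReduction.TrivializedHerglotzEquations L₀ h g z,
      HerglotzReduction.ReducedPrinciple ρ (HerglotzReduction.reducedLagrangian Lext) h ξ z α,
      HerglotzReduction.EulerPoincareHerglotzEquations ρ
        (HerglotzReduction.reducedLagrangian Lext) h (g 0) α₀ ξ z α] := by
  obtain rfl : L₀ = fun v w => Lext v w α₀ := funext₂ hL₀
  obtain rfl : ξ = HerglotzReduction.bodyVelocity h g := funext hξ
  obtain rfl : α = fun t => α₀.comp (ρ (g t)) := funext fun t => by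
    rw [hα, HerglotzReduction.dualRep, inv_inv]
  have hℓ := HerglotzReduction.contDiff_reducedLagrangian hL
  have hρ' := hρ.mdifferentiable (by simp)
  rw [HerglotzReduction.eulerPoincareHerglotzEquations_iff (hρ' 1) (hg.mdifferentiableOn (by simp)),
    HerglotzReduction.herglotzEquations_iff hρ hℓ hinv hh hg hz,
    HerglotzReduction.trivializedHerglotzEquations_iff hρ' (hℓ.differentiable (by simp)) hinv]
  tfae_have 2 ↔ 3 := Iff.rfl
  tfae_have 3 ↔ 5 := Iff.rfl
  tfae_have 5 → 4 :=
    HerglotzReduction.reducedPrinciple_of_momentumEquations (hℓ.of_le (by simp)) hh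
  tfae_have 4 → 1 := HerglotzReduction.herglotzPrinciple_of_reducedPrinciple hρ hinv hh
  tfae_have 1 → 5 := HerglotzReduction.momentumEquations_of_herglotzPrinciple hρ hℓ hinv hh hg hz
  tfae_finish
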